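/- Let $M,N\ge 0$ be integers. For $1\le i\le M+N$ put $|i|=0$ if $i\le M$ and $|i|=1$ if $i>M$. The super Yangian $Y=Y(\mathfrak{gl}_{M|N})$ is the associative $\mathbb{Z}/2$-graded algebra over $\mathbb{C}$ with generators $t_{ij}^{(r)}$ ($1\le i,j\le M+N$, $r\ge 0$), where $t_{ij}^{(0)}=\delta_{ij}$ and $t_{ij}^{(r)}$ has parity $|i|+|j|$ for $r\ge1$, and defining relations $$[t_{ij}^{(r)},t_{hk}^{(s)}]=(-1)^{|i||j|+|i||h|+|j||h|}\sum_{t=0}^{\min(r,s)-1}\Big(t_{hj}^{(t)}t_{ik}^{(r+s-1-t)}-t_{hj}^{(r+s-1-t)}t_{ik}^{(t)}\Big),$$ where $[\cdot,\cdot]$ is the supercommutator, $[x,y]=xy-(-1)^{|x||y|}yx$ for homogeneous $x,y$. Let $\lambda=(\mu_1,\dots,\mu_m)$ be a composition of $M$ and $\nu=(\mu_{m+1},\dots,\mu_{m+n})$ a composition of $N$ (all parts positive). The matrix $T(u)=\big(\sum_{r\ge0}t_{ij}^{(r)}u^{-r}\big)_{i,j}$ over $Y[[u^{-1}]]$ has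 a unique block Gauss decomposition $T(u)=F(u)D(u)E(u)$ with respect to the block sizes $\mu_1,\dots,\mu_{m+n}$, where $D(u)$ is block diagonal, $F(u)$ is block lower triangular and $E(u)$ is block upper triangular, both with identity diagonal blocks, and the off-diagonal blocks of $E(u)$ and $F(u)$ have no constant term. For $1\le a<m+n$ and $r\ge 1$ let $E_{a;i,j}^{(r)}$ ($1\le i\le\mu_a$, $1\le j\le\mu_{a+1}$) be the coefficient of $u^{-r}$ in the $(i,j)$ entry of the $(a,a+1)$ block of $E(u)$, and let $F_{a;i,j}^{(r)}$ ($1\le i\le\mu_{a+1}$, $1\le j\le\mu_a$) be the coefficient of $u^{-r}$ in the $(i,j)$ entry of the $(a+1,a)$ block of $F(u)$. Lemma. Suppose that $m>1$ and $n>1$. Then in $Y$ $$\big[\,[E_{m-1;i,j}^{(r)},E_{m;h,k}^{(1)}],\,[E_{m;h_0,k_0}^{(1)},E_{m+1;f,g}^{(s)}]\,\big]=0,$$ $$\big[\,[F_{m-1;i,j}^{(r)},F_{m;h,k}^{(1)}],\,[F_{m;h_0,k_0}^{(1)},F_{m+1;f,g}^{(s)}]\,\big]=0$$ for all $r,s\ge1$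 and all entry positions $i,j,h,k,h_0,k_0,f,g$ for which the symbols in the respective identity are defined. -/

import Mathlib

namespace SuperYangian

open PowerSeries

/-! ### Superalgebras

A `ℤ/2`-grading on a complex algebra `A` is the same thing as an algebra automorphism `σ` of `A`
with `σ ∘ σ = id`: the even part is the `+1`-eigenspace of `σ` and the odd part is the
`-1`-eigenspace. We call `σ` the parity automorphism. -/

section Super

variable {A : Type*} [Ring A] [Algebra ℂ A]

/-- The even component of `x`, for the grading with parity automorphism `σ`. -/
noncomputable def evenPart (σ : A →ₐ[ℂ] A) (x : A) : A := (2⁻¹ : ℂ) • (x + σ x)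

/-- The odd component of `x`, for the grading with parity automorphism `σ`. -/
noncomputable def oddPart (σ : A →ₐ[ℂ] A) (x : A) : A := (2⁻¹ : ℂ) • (x - σ x)

/-- The supercommutator: the bilinear map with `[x, y] = x y - (-1)^(|x| |y|) y x` for
homogeneous `x` and `y` (see `superBracket_of_homogeneous`). -/
noncomputable def superBracket (σ : A →ₐ[ℂ] A) (x y : A) : A :=
  x * y - (evenPart σ y * evenPart σ x + evenPart σ y * oddPart σ x
    + oddPart σ y * evenPart σ x - oddPart σ y * oddPart σ x)

theorem neg_one_pow_mod (p : ℕ) : ((-1 : ℂ) ^ p = 1 ∧ Even p) ∨ ((-1 : ℂ) ^ p = -1 ∧ Odd p) := by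
  rcases Nat.even_or_odd p with h | h
  · exact Or.inl ⟨h.neg_one_pow, h⟩
  · exact Or.inr ⟨h.neg_one_pow, h⟩

theorem superBracket_of_homogeneous (σ : A →ₐ[ℂ] A) {x y : A} {p q : ℕ}
    (hx : σ x = (-1 : ℂ) ^ p • x) (hy : σ y = (-1 : ℂ) ^ q • y) :
    superBracket σ x y = x * y - (-1 : ℂ) ^ (p * q) • (y * x) := by
  have h2 : ∀ z : A, (2⁻¹ : ℂ) • (z + z) = z := fun z => by
    rw [← two_smul ℂ z, smul_smul]; norm_num
  rcases neg_one_pow_mod p with ⟨hp, hp'⟩ | ⟨hp, hp'⟩ <;>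
  rcases neg_one_pow_mod q with ⟨hq, hq'⟩ | ⟨hq, hq'⟩ <;>
  rw [hp] at hx <;> rw [hq] at hy
  · rw [(hp'.mul_right q).neg_one_pow]; simp [superBracket, evenPart, oddPart, hx, hy, h2]
  · rw [(hp'.mul_right q).neg_one_pow]; simp [superBracket, evenPart, oddPart, hx, hy, h2]
  · rw [(hq'.mul_left p).neg_one_pow]; simp [superBracket, evenPart, oddPart, hx, hy, h2]
  · rw [(hp'.mul hq').neg_one_pow]; simp [superBracket, evenPart, oddPart, hx, hy, h2]

theorem map_superBracket {B : Type*} [Ring B] [Algebra ℂ B] (σ : A →ₐ[ℂ] A) (τ : B →ₐ[ℂ] B)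
    (f : A →ₐ[ℂ] B) (h : ∀ x, f (σ x) = τ (f x)) (x y : A) :
    f (superBracket σ x y) = superBracket τ (f x) (f y) := by
  simp [superBracket, evenPart, oddPart, h]

theorem superBracket_smul_smul (σ : A →ₐ[ℂ] A) (a b : ℂ) (x y : A) :
    superBracket σ (a • x) (b • y) = (a * b) • superBracket σ x y := by
  have he : ∀ (c : ℂ) (z : A), evenPart σ (c • z) = c • evenPart σ z := fun c z => by
    simp only [evenPart, map_smul, ← smul_add, smul_comm c]
  have ho : ∀ (c : ℂ) (z : A), oddPart σ (c • z) = c • oddPart σ z := fun c z => by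
    simp only [oddPart, map_smul, ← smul_sub, smul_comm c]
  simp only [superBracket, he, ho, smul_mul_smul_comm, mul_comm b a, smul_sub, smul_add]

end Super

/-! ### The super Yangian of `gl(M|N)` -/

section Yangian

variable (M N : ℕ)

/-- The parity of an index: `0` for the first `M` indices, `1` for the last `N`
(indices are counted from `0` here). -/
def parity (i : Fin (M + N)) : ℕ := if i.val < M then 0 else 1

/-- The free algebra on symbols `(i, j, r)`; the symbol `(i, j, r)` stands for `t_{ij}^{(r+1)}`. -/
abbrev Free : Type := FreeAlgebra ℂ (Fin (M + N) × Fin (M + N) × ℕ)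

/-- `t_{ij}^{(r)}` in the free algebra, with `t_{ij}^{(0)} = δ_{ij}`. -/
noncomputable def freeGen (i j : Fin (M + N)) : ℕ → Free M N
  | 0 => if i = j then 1 else 0
  | r + 1 => FreeAlgebra.ι ℂ (i, j, r)

/-- The parity automorphism of the free algebra: `t_{ij}^{(r)}` has parity `|i| + |j|`. -/
noncomputable def freeParity : Free M N →ₐ[ℂ] Free M N :=
  FreeAlgebra.lift ℂ fun x =>
    (-1 : ℂ) ^ (parity M N x.1 + parity M N x.2.1) • FreeAlgebra.ι ℂ x

/-- The defining relations
`[t_{ij}^{(r)}, t_{hk}^{(s)}] = (-1)^{|i||j|+|i||h|+|j||h|}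
  ∑_{t=0}^{min(r,s)-1} (t_{hj}^{(t)} t_{ik}^{(r+s-1-t)} - t_{hj}^{(r+s-1-t)} t_{ik}^{(t)})`. -/
inductive Rel : Free M N → Free M N → Prop
  | comm (i j h k : Fin (M + N)) (r s : ℕ) :
      Rel (superBracket (freeParity M N) (freeGen M N i j r) (freeGen M N h k s))
        ((-1 : ℂ) ^ (parity M N i * parity M N j + parity M N i * parity M N h
            + parity M N j * parity M N h) •
          ∑ t ∈ Finset.range (min r s),
            (freeGen M N h j t * freeGen M N i k (r + s - 1 - t)
              - freeGen M N h j (r + s - 1 - t) * freeGen M N i k t))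

/-- The super Yangian `Y(gl(M|N))`. -/
def Y : Type := RingQuot (Rel M N)

noncomputable instance : Ring (Y M N) := inferInstanceAs (Ring (RingQuot (Rel M N)))

noncomputable instance : Algebra ℂ (Y M N) := inferInstanceAs (Algebra ℂ (RingQuot (Rel M N)))

/-- The canonical projection from the free algebra. -/
noncomputable def proj : Free M N →ₐ[ℂ] Y M N := RingQuot.mkAlgHom ℂ (Rel M N)

/-- The element `t_{ij}^{(r)}` of the super Yangian. -/
noncomputable def gen (i j : Fin (M + N)) (r : ℕ) : Y M N := proj M N (freeGen M N i j r)

theorem freeParity_freeGen (i j : Fin (M + N)) (r : ℕ) :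
    freeParity M N (freeGen M N i j r) =
      (-1 : ℂ) ^ (parity M N i + parity M N j) • freeGen M N i j r := by
  cases r with
  | zero =>
    by_cases h : i = j
    · subst h; simp [freeGen, ← two_mul]
    · simp [freeGen, h]
  | succ r => simp [freeGen, freeParity]

theorem proj_freeParity_rel ⦃x y : Free M N⦄ (hxy : Rel M N x y) :
    ((proj M N).comp (freeParity M N)) x = ((proj M N).comp (freeParity M N)) y := by
  have hrel := RingQuot.mkAlgHom_rel ℂ hxy
  change proj M N x = proj M N y at hrel
  obtain ⟨i, j, h, k, r, s⟩ := hxy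
  set c : ℂ := (-1 : ℂ) ^ (parity M N i * parity M N j + parity M N i * parity M N h
            + parity M N j * parity M N h) with hc
  set e : ℂ := (-1 : ℂ) ^ (parity M N i + parity M N j)
      * (-1 : ℂ) ^ (parity M N h + parity M N k) with he
  have e1 : (-1 : ℂ) ^ (parity M N h + parity M N j) * (-1 : ℂ) ^ (parity M N i + parity M N k)
      = e := by rw [he, ← pow_add, ← pow_add]; congr 1; ring
  have h1 : freeParity M N
      (superBracket (freeParity M N) (freeGen M N i j r) (freeGen M N h k s))
      = e • superBracket (freeParity M N) (freeGen M N i j r) (freeGen M N h k s) := by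
    rw [map_superBracket _ (freeParity M N) _ (fun _ => rfl), freeParity_freeGen,
      freeParity_freeGen, superBracket_smul_smul]
  have h2 : ∀ u v, freeParity M N (freeGen M N h j u * freeGen M N i k v)
      = e • (freeGen M N h j u * freeGen M N i k v) := fun u v => by
    rw [map_mul, freeParity_freeGen, freeParity_freeGen, smul_mul_smul_comm, e1]
  rw [AlgHom.comp_apply, AlgHom.comp_apply, h1, map_smul, hrel, map_smul,
    map_smul (freeParity M N), map_sum (freeParity M N)]
  simp only [map_sub (freeParity M N), h2]
  rw [map_smul, smul_comm]
  congr 1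
  simp only [← smul_sub, ← Finset.smul_sum, map_smul]

/-- The parity automorphism of the super Yangian, defining its `ℤ/2`-grading:
`t_{ij}^{(r)}` has parity `|i| + |j|`. -/
noncomputable def parityAut : Y M N →ₐ[ℂ] Y M N :=
  RingQuot.liftAlgHom ℂ ⟨(proj M N).comp (freeParity M N), proj_freeParity_rel M N⟩

theorem parityAut_proj (x : Free M N) :
    parityAut M N (proj M N x) = proj M N (freeParity M N x) :=
  RingQuot.liftAlgHom_mkAlgHom_apply ℂ _ (proj_freeParity_rel M N) x

theorem parityAut_gen (i j : Fin (M + N)) (r : ℕ) :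
    parityAut M N (gen M N i j r) =
      (-1 : ℂ) ^ (parity M N i + parity M N j) • gen M N i j r := by
  rw [gen, parityAut_proj, freeParity_freeGen, map_smul]

theorem parityAut_parityAut (x : Y M N) : parityAut M N (parityAut M N x) = x := by
  obtain ⟨x, rfl⟩ : ∃ z, proj M N z = x := RingQuot.mkAlgHom_surjective ℂ (Rel M N) x
  rw [parityAut_proj, parityAut_proj]
  congr 1
  have : (freeParity M N).comp (freeParity M N) = AlgHom.id ℂ _ := by
    ext ⟨i, j, r⟩
    have := freeParity_freeGen M N i j (r + 1)
    simp only [freeGen] at this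
    simp only [Function.comp_apply, AlgHom.comp_apply, this, map_smul, smul_smul, ← pow_add,
      AlgHom.id_apply]
    simp [← two_mul]
  exact DFunLike.congr_fun this x

/-- The series `t_{ij}(u) = ∑_r t_{ij}^{(r)} u^{-r}`, as a formal power series in `X = u^{-1}`. -/
noncomputable def genSeries (i j : Fin (M + N)) : (Y M N)⟦X⟧ := PowerSeries.mk (gen M N i j)

/-- The matrix `T(u) = (t_{ij}(u))`. -/
noncomputable def T : Matrix (Fin (M + N)) (Fin (M + N)) (Y M N)⟦X⟧ :=
  Matrix.of (genSeries M N)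

end Yangian

/-! ### Block Gauss decomposition -/

section One

variable {R : Type*} [Ring R] {ι : Type*} [DecidableEq ι]

theorem coeff_one_apply (n : ℕ) (hn : 0 < n) (i j : ι) :
    coeff n ((1 : Matrix ι ι R⟦X⟧) i j) = 0 := by
  by_cases h : i = j
  · subst h; simp [coeff_one, hn.ne']
  · simp [h]

theorem coeff_zero_one_apply (i j : ι) :
    coeff 0 ((1 : Matrix ι ι R⟦X⟧) i j) = (1 : Matrix ι ι R) i j := by
  by_cases h : i = j
  · subst h; simp
  · simp [h]

end One

section Gauss

variable {R : Type*} [Ring R] {ι κ : Type*} [Fintype ι] [DecidableEq ι] [LinearOrder κ]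

/-- `T = F D E` with `D` block diagonal, `F` lower and `E` upper block unitriangular, where `b i`
is the block containing the index `i`. The off-diagonal blocks of `F` and `E` are series
`∑_{r ≥ 1}`, without constant term. -/
structure IsGaussDecomposition (b : ι → κ) (T F D E : Matrix ι ι R⟦X⟧) : Prop where
  eq_mul : T = F * D * E
  diag : ∀ i j, b i ≠ b j → D i j = 0
  lower : ∀ i j, b i < b j → F i j = 0
  lower_unit : ∀ i j, b i = b j → F i j = (1 : Matrix ι ι R⟦X⟧) i j
  lower_coeff : ∀ i j, b j < b i → coeff 0 (F i j) = 0
  upper : ∀ i j, b j < b i → E i j = 0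
  upper_unit : ∀ i j, b i = b j → E i j = (1 : Matrix ι ι R⟦X⟧) i j
  upper_coeff : ∀ i j, b i < b j → coeff 0 (E i j) = 0

/-! The remaining facts of this section show that a matrix of series with constant term `1` has
exactly one block Gauss decomposition. They are proved coefficient by coefficient, in the ring
`S⟦X⟧` with `S` the ring of matrices over `R`. -/

section Coeff

variable {S : Type*} [Ring S]

/-- The part of degree less than `n`. -/
noncomputable def cut (n : ℕ) (f : S⟦X⟧) : S⟦X⟧ :=
  PowerSeries.mk fun k => if k < n then coeff k f else 0

/-- The part of degree at least `n`, divided by `X ^ n`. -/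
noncomputable def tail (n : ℕ) (f : S⟦X⟧) : S⟦X⟧ := PowerSeries.mk fun k => coeff (k + n) f

theorem cut_add_tail (n : ℕ) (f : S⟦X⟧) : f = cut n f + X ^ n * tail n f := by
  ext k
  rw [map_add, coeff_X_pow_mul']
  by_cases h : k < n
  · simp [cut, h]
  · simp [cut, tail, h, not_lt.mp h]

theorem coeff_mul_three (n : ℕ) (hn : 0 < n) (f d e : S⟦X⟧) (hf : coeff 0 f = 1)
    (hd : coeff 0 d = 1) (he : coeff 0 e = 1) :
    coeff n (f * d * e) =
      coeff n f + coeff n d + coeff n e + coeff n (cut n f * cut n d * cut n e) := by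
  have key : f * d * e = cut n f * cut n d * cut n e
      + X ^ n * (tail n f * d * e + cut n f * tail n d * e + cut n f * cut n d * tail n e) := by
    have hX : ∀ g : S⟦X⟧, g * X ^ n = X ^ n * g := fun g => ((commute_X_pow g n).eq)
    have h1 : f * d * e = cut n f * d * e + X ^ n * (tail n f * d * e) := by
      conv_lhs => rw [cut_add_tail n f]
      simp only [add_mul, mul_assoc]
    have h2 : cut n f * d * e = cut n f * cut n d * e + X ^ n * (cut n f * tail n d * e) := by
      conv_lhs => rw [cut_add_tail n d]
      simp only [mul_add, add_mul, ← mul_assoc, hX]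
    have h3 : cut n f * cut n d * e
        = cut n f * cut n d * cut n e + X ^ n * (cut n f * cut n d * tail n e) := by
      conv_lhs => rw [cut_add_tail n e]
      simp only [mul_add, ← mul_assoc, hX]
    rw [h1, h2, h3]
    simp only [mul_add]
    abel
  have c0 : ∀ g : S⟦X⟧, coeff 0 g = 1 → coeff 0 (cut n g) = 1 := fun g hg => by
    simp [cut, hn, ← hg]
  have t0 : ∀ g : S⟦X⟧, coeff 0 (tail n g) = coeff n g := fun g => by simp [tail]
  have m0 : ∀ g h : S⟦X⟧, coeff 0 (g * h) = coeff 0 g * coeff 0 h := fun g h => by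
    simp [coeff_mul]
  rw [key, map_add, coeff_X_pow_mul']
  simp only [le_refl, if_true, Nat.sub_self, map_add, m0, c0 f hf, c0 d hd, t0, hd, he,
    one_mul, mul_one]
  abel

/-- The sequence solving `f * d * e = t` degree by degree, where the coefficients of `f`, `d`, `e`
of positive degree `n` are the images under `p`, `q`, `w` of the `n`-th term. -/
noncomputable def solve (p q w : S → S) (t : S⟦X⟧) (n : ℕ) : S :=
  coeff n t - coeff n
    (PowerSeries.mk (fun k => if _h : k < n then (if k = 0 then 1 else p (solve p q w t k)) else 0)
    * PowerSeries.mk (fun k => if _h : k < n then (if k = 0 then 1 else q (solve p q w t k)) else 0)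
    * PowerSeries.mk (fun k => if _h : k < n then (if k = 0 then 1 else w (solve p q w t k)) else 0))
termination_by n

theorem exists_mul_three (p q w : S → S) (hpqw : ∀ x, p x + q x + w x = x) (t : S⟦X⟧)
    (ht : coeff 0 t = 1) :
    ∃ f d e : S⟦X⟧, t = f * d * e ∧ coeff 0 f = 1 ∧ coeff 0 d = 1 ∧ coeff 0 e = 1 ∧
      ∀ n, 0 < n → ∃ x, coeff n f = p x ∧ coeff n d = q x ∧ coeff n e = w x := by
  set x := solve p q w t with hx
  refine ⟨PowerSeries.mk fun k => if k = 0 then 1 else p (x k),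
    PowerSeries.mk fun k => if k = 0 then 1 else q (x k),
    PowerSeries.mk fun k => if k = 0 then 1 else w (x k), ?_, by simp, by simp, by simp,
    fun n hn => ⟨x n, by simp [hn.ne'], by simp [hn.ne'], by simp [hn.ne']⟩⟩
  ext n
  rcases Nat.eq_zero_or_pos n with rfl | hn
  · simp [coeff_mul, ht]
  · rw [coeff_mul_three n hn _ _ _ (by simp) (by simp) (by simp)]
    simp only [coeff_mk, hn.ne', if_false, hpqw]
    rw [hx, solve]
    simp [cut]

theorem mul_three_unique {f d e f' d' e' : S⟦X⟧} (h : f * d * e = f' * d' * e')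
    (hf : coeff 0 f = 1) (hd : coeff 0 d = 1) (he : coeff 0 e = 1)
    (hf' : coeff 0 f' = 1) (hd' : coeff 0 d' = 1) (he' : coeff 0 e' = 1)
    (hs : ∀ n, 0 < n → coeff n f + coeff n d + coeff n e = coeff n f' + coeff n d' + coeff n e' →
      coeff n f = coeff n f' ∧ coeff n d = coeff n d' ∧ coeff n e = coeff n e') :
    f = f' ∧ d = d' ∧ e = e' := by
  have key : ∀ n, coeff n f = coeff n f' ∧ coeff n d = coeff n d' ∧ coeff n e = coeff n e' := by
    intro n
    induction n using Nat.strong_induction_on with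
    | _ n ih =>
      rcases Nat.eq_zero_or_pos n with rfl | hn
      · exact ⟨hf.trans hf'.symm, hd.trans hd'.symm, he.trans he'.symm⟩
      · have cf : cut n f = cut n f' := by
          ext k; by_cases hk : k < n <;> simp [cut, hk, (ih k · |>.1)]
        have cd : cut n d = cut n d' := by
          ext k; by_cases hk : k < n <;> simp [cut, hk, (ih k · |>.2.1)]
        have ce : cut n e = cut n e' := by
          ext k; by_cases hk : k < n <;> simp [cut, hk, (ih k · |>.2.2)]
        have h1 := coeff_mul_three n hn f d e hf hd he
        have h2 := coeff_mul_three n hn f' d' e' hf' hd' he'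
        rw [h, h2, cf, cd, ce] at h1
        exact hs n hn (add_right_cancel h1).symm
  exact ⟨PowerSeries.ext fun n => (key n).1, PowerSeries.ext fun n => (key n).2.1,
    PowerSeries.ext fun n => (key n).2.2⟩

end Coeff

/-- A matrix of series as a series of matrices. -/
noncomputable def toSeries (A : Matrix ι ι R⟦X⟧) : (Matrix ι ι R)⟦X⟧ :=
  PowerSeries.mk fun n => A.map (coeff n)

/-- A series of matrices as a matrix of series. -/
noncomputable def ofSeries (f : (Matrix ι ι R)⟦X⟧) : Matrix ι ι R⟦X⟧ :=
  Matrix.of fun i j => PowerSeries.mk fun n => coeff n f i j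

theorem toSeries_mul (A B : Matrix ι ι R⟦X⟧) : toSeries (A * B) = toSeries A * toSeries B := by
  ext n i j
  simp only [toSeries, coeff_mk, coeff_mul, Matrix.map_apply, Matrix.mul_apply, map_sum,
    Matrix.sum_apply]
  exact Finset.sum_comm

theorem toSeries_ofSeries (f : (Matrix ι ι R)⟦X⟧) : toSeries (ofSeries f) = f := by
  ext n i j
  simp [toSeries, ofSeries]

theorem coeff_toSeries (A : Matrix ι ι R⟦X⟧) (n : ℕ) (i j : ι) :
    coeff n (toSeries A) i j = coeff n (A i j) := by simp [toSeries]

theorem toSeries_injective : Function.Injective (toSeries (R := R) (ι := ι)) := by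
  intro A B h
  ext i j n
  rw [← coeff_toSeries, ← coeff_toSeries, h]

theorem IsGaussDecomposition.coeff_zero {b : ι → κ} {T F D E : Matrix ι ι R⟦X⟧}
    (h : IsGaussDecomposition b T F D E) (hT : coeff 0 (toSeries T) = 1) :
    coeff 0 (toSeries F) = 1 ∧ coeff 0 (toSeries D) = 1 ∧ coeff 0 (toSeries E) = 1 := by
  have hF : coeff 0 (toSeries F) = 1 := by
    ext i j
    rw [coeff_toSeries]
    rcases lt_trichotomy (b i) (b j) with hb | hb | hb
    · rw [h.lower i j hb, Matrix.one_apply_ne (fun e => hb.ne (by rw [e])), map_zero]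
    · rw [h.lower_unit i j hb, coeff_zero_one_apply]
    · rw [h.lower_coeff i j hb, Matrix.one_apply_ne (fun e => hb.ne (by rw [e]))]
  have hE : coeff 0 (toSeries E) = 1 := by
    ext i j
    rw [coeff_toSeries]
    rcases lt_trichotomy (b i) (b j) with hb | hb | hb
    · rw [h.upper_coeff i j hb, Matrix.one_apply_ne (fun e => hb.ne (by rw [e]))]
    · rw [h.upper_unit i j hb, coeff_zero_one_apply]
    · rw [h.upper i j hb, Matrix.one_apply_ne (fun e => hb.ne (by rw [e])), map_zero]
  refine ⟨hF, ?_, hE⟩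
  have m0 : ∀ g h : (Matrix ι ι R)⟦X⟧, coeff 0 (g * h) = coeff 0 g * coeff 0 h := fun g h => by
    simp [coeff_mul]
  rwa [h.eq_mul, toSeries_mul, toSeries_mul, m0, m0, hF, hE, one_mul, mul_one] at hT

theorem existsUnique_gauss (b : ι → κ) (T : Matrix ι ι R⟦X⟧) (hT : coeff 0 (toSeries T) = 1) :
    ∃! P : Matrix ι ι R⟦X⟧ × Matrix ι ι R⟦X⟧ × Matrix ι ι R⟦X⟧,
      IsGaussDecomposition b T P.1 P.2.1 P.2.2 := by
  obtain ⟨f, d, e, hfde, hf, hd, he, hn⟩ := exists_mul_three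
    (p := fun A : Matrix ι ι R => Matrix.of fun i j => if b j < b i then A i j else 0)
    (q := fun A : Matrix ι ι R => Matrix.of fun i j => if b i = b j then A i j else 0)
    (w := fun A : Matrix ι ι R => Matrix.of fun i j => if b i < b j then A i j else 0)
    (fun A => by
      ext i j
      rcases lt_trichotomy (b i) (b j) with hb | hb | hb
      · simp [hb, hb.ne, hb.not_gt]
      · simp [hb]
      · simp [hb, hb.ne', hb.not_gt]) (toSeries T) hT
  refine ⟨(ofSeries f, ofSeries d, ofSeries e), ?_, ?_⟩
  · refine ⟨?_, ?_, ?_, ?_, ?_, ?_, ?_, ?_⟩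
    · apply toSeries_injective
      rw [toSeries_mul, toSeries_mul]
      simp only [toSeries_ofSeries, hfde]
    all_goals
      intro i j hb
      have hne : ∀ {a c : κ}, a ≠ c → b i = a → b j = c → i ≠ j :=
        fun h h1 h2 hij => h (h1.symm.trans ((congrArg b hij).trans h2))
    · ext n
      rcases Nat.eq_zero_or_pos n with rfl | h0
      · simp [ofSeries, hd, Matrix.one_apply_ne (hne hb rfl rfl)]
      · obtain ⟨x, -, h2, -⟩ := hn n h0
        simp [ofSeries, h2, hb]
    · ext n
      rcases Nat.eq_zero_or_pos n with rfl | h0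
      · simp [ofSeries, hf, Matrix.one_apply_ne (hne hb.ne rfl rfl)]
      · obtain ⟨x, h2, -, -⟩ := hn n h0
        simp [ofSeries, h2, hb.not_gt]
    · ext n
      rcases Nat.eq_zero_or_pos n with rfl | h0
      · rw [coeff_zero_one_apply]; simp [ofSeries, hf]
      · obtain ⟨x, h2, -, -⟩ := hn n h0
        rw [coeff_one_apply n h0]
        simp [ofSeries, h2, hb]
    · simp [ofSeries, hf, Matrix.one_apply_ne (hne hb.ne' rfl rfl)]
    · ext n
      rcases Nat.eq_zero_or_pos n with rfl | h0
      · simp [ofSeries, he, Matrix.one_apply_ne (hne hb.ne' rfl rfl)]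
      · obtain ⟨x, -, -, h2⟩ := hn n h0
        simp [ofSeries, h2, hb.not_gt]
    · ext n
      rcases Nat.eq_zero_or_pos n with rfl | h0
      · rw [coeff_zero_one_apply]; simp [ofSeries, he]
      · obtain ⟨x, -, -, h2⟩ := hn n h0
        rw [coeff_one_apply n h0]
        simp [ofSeries, h2, hb]
    · simp [ofSeries, he, Matrix.one_apply_ne (hne hb.ne rfl rfl)]
  · rintro ⟨F, D, E⟩ h
    simp only at h
    obtain ⟨hF, hD, hE⟩ := h.coeff_zero hT
    have heq : toSeries F * toSeries D * toSeries E = f * d * e := by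
      rw [← toSeries_mul, ← toSeries_mul, ← h.eq_mul, hfde]
    obtain ⟨h1, h2, h3⟩ := mul_three_unique heq hF hD hE hf hd he (by
      intro n h0 hsum
      obtain ⟨x, x1, x2, x3⟩ := hn n h0
      have hsum' : ∀ i j, coeff n (F i j) + coeff n (D i j) + coeff n (E i j) = x i j := by
        intro i j
        have := congrFun (congrFun hsum i) j
        simp only [Matrix.add_apply, coeff_toSeries, x1, x2, x3, Matrix.of_apply] at this
        rw [this]
        rcases lt_trichotomy (b i) (b j) with hb | hb | hb
        · simp [hb, hb.ne, hb.not_gt]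
        · simp [hb]
        · simp [hb, hb.ne', hb.not_gt]
      refine ⟨?_, ?_, ?_⟩ <;> ext i j <;> have := hsum' i j <;>
        simp only [coeff_toSeries, x1, x2, x3, Matrix.of_apply] <;>
        rcases lt_trichotomy (b i) (b j) with hb | hb | hb
      · simp [h.lower i j hb, hb.not_gt]
      · simp [h.lower_unit i j hb, coeff_one_apply n h0, hb]
      · rw [← this]
        simp [h.diag i j hb.ne', h.upper i j hb, hb]
      · simp [h.diag i j hb.ne, hb.ne]
      · rw [← this]
        simp [h.lower_unit i j hb, h.upper_unit i j hb, coeff_one_apply n h0, hb]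
      · simp [h.diag i j hb.ne', hb.ne']
      · rw [← this]
        simp [h.diag i j hb.ne, h.lower i j hb, hb]
      · simp [h.upper_unit i j hb, coeff_one_apply n h0, hb]
      · simp [h.upper i j hb, hb.not_gt])
    refine Prod.ext ?_ (Prod.ext ?_ ?_) <;> apply toSeries_injective <;>
      simp only [toSeries_ofSeries, h1, h2, h3]

end Gauss

/-! ### The generators attached to a pair of compositions -/

section Blocks

variable {M N : ℕ} (lam : Composition M) (nu : Composition N)

theorem coeff_zero_T : coeff 0 (toSeries (T M N)) = 1 := by
  ext i j
  rw [coeff_toSeries]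
  by_cases h : i = j
  · subst h; simp [T, genSeries, gen, freeGen]
  · simp [T, genSeries, gen, freeGen, h]

/-- The block Gauss decomposition `T(u) = F(u) D(u) E(u)` attached to the composition
`μ = (λ | ν)`, as the triple `(F(u), D(u), E(u))`. -/
noncomputable def gauss :
    Matrix (Fin (M + N)) (Fin (M + N)) (Y M N)⟦X⟧ × Matrix (Fin (M + N)) (Fin (M + N)) (Y M N)⟦X⟧ ×
      Matrix (Fin (M + N)) (Fin (M + N)) (Y M N)⟦X⟧ :=
  (existsUnique_gauss (lam.append nu).index (T M N) coeff_zero_T).choose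

theorem gauss_spec :
    IsGaussDecomposition (lam.append nu).index (T M N)
      (gauss lam nu).1 (gauss lam nu).2.1 (gauss lam nu).2.2 :=
  (existsUnique_gauss (lam.append nu).index (T M N) coeff_zero_T).choose_spec.1

theorem gauss_unique {F D E : Matrix (Fin (M + N)) (Fin (M + N)) (Y M N)⟦X⟧}
    (h : IsGaussDecomposition (lam.append nu).index (T M N) F D E) :
    (F, D, E) = gauss lam nu :=
  (existsUnique_gauss (lam.append nu).index (T M N) coeff_zero_T).choose_spec.2 (F, D, E) h

theorem length_append : (lam.append nu).length = lam.length + nu.length := by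
  simp [Composition.append, Composition.length]

/-- The block position `a`, for `1 ≤ a ≤ m + n` counted from `1`, where `m` and `n` are the numbers
of parts of `λ` and `ν`. -/
def block (a : ℕ) (ha : 1 ≤ a ∧ a ≤ lam.length + nu.length) : Fin (lam.append nu).length :=
  ⟨a - 1, by rw [length_append]; omega⟩

/-- The entry positions of the block position `a`: there are `μ_a` of them. -/
abbrev Entry (a : ℕ) (ha : 1 ≤ a ∧ a ≤ lam.length + nu.length) : Type :=
  Fin ((lam.append nu).blocksFun (block lam nu a ha))

/-- The row or column of `T(u)` with entry position `i` in the block position `a`. -/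
def row (a : ℕ) (ha : 1 ≤ a ∧ a ≤ lam.length + nu.length) (i : Entry lam nu a ha) : Fin (M + N) :=
  (lam.append nu).embedding (block lam nu a ha) i

/-- `E_{a;i,j}^{(r)}`, the coefficient of `u^{-r}` in the entry `(i, j)` of the block `(a, a + 1)`
of `E(u)`, for `1 ≤ a < m + n`. -/
noncomputable def E (a : ℕ) (ha : 1 ≤ a ∧ a < lam.length + nu.length)
    (i : Entry lam nu a ⟨ha.1, ha.2.le⟩) (j : Entry lam nu (a + 1) ⟨Nat.le_add_left 1 a, ha.2⟩)
    (r : ℕ) : Y M N :=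
  coeff r ((gauss lam nu).2.2 (row lam nu a _ i) (row lam nu (a + 1) _ j))

/-- `F_{a;i,j}^{(r)}`, the coefficient of `u^{-r}` in the entry `(i, j)` of the block `(a + 1, a)`
of `F(u)`, for `1 ≤ a < m + n`. -/
noncomputable def F (a : ℕ) (ha : 1 ≤ a ∧ a < lam.length + nu.length)
    (i : Entry lam nu (a + 1) ⟨Nat.le_add_left 1 a, ha.2⟩) (j : Entry lam nu a ⟨ha.1, ha.2.le⟩)
    (r : ℕ) : Y M N :=
  coeff r ((gauss lam nu).1 (row lam nu (a + 1) _ i) (row lam nu a _ j))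

/-- The supercommutator of the super Yangian. -/
noncomputable def bracket (x y : Y M N) : Y M N := superBracket (parityAut M N) x y

end Blocks

end SuperYangian

open SuperYangian

/-! Put $W=FD$ and $V=W^{-1}$, both block lower triangular, so that $E=VT$ and $E^{-1}=T^{-1}W$. Let
$i,h,k,g$ lie in the blocks $m-1,m,m+1,m+2$. The coefficients $E_{m;h,k}^{(1)}$ are just
$t_{hk}^{(1)}$, and supercommuting with $t_{hk}^{(1)}$ is a superderivation acting on the entries of
$T$ and $T^{-1}$ by matrix units.

The inner brackets are therefore computable. On the left, $[E_{ij}^{(r)},t_{hk}^{(1)}]$ is a scalar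
times $E_{ik}^{(r)}$, an entry two blocks off the diagonal (`exists_superBracket_E`). On the right,
$E_{fg}=-(E^{-1})_{fg}$ because the blocks are consecutive, and the bracket is a scalar times
$(E^{-1})_{h_0g}^{(s)}$ (`exists_superBracket_inverse`).

It remains to see that $E_{ik}$ and $(E^{-1})_{hg}$ supercommute (`superBracket_E_inverse`). The
entry $E_{ik}$ involves only $t_{pq}$ with $p$ in a block up to $m-1$, and $q$ in such a block or
equal to $k$. The entry $(E^{-1})_{hg}$ involves only entries $(a,c)$ of $T^{-1}$ with $c$ in a
block from $m+2$ on, and $a$ in such a block or equal to $h$. Since $t_{pq}$ supercommutes with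
$(T^{-1})_{ac}$ when $p\ne c$ and $q\ne a$ (`twistedCommutator_inverse_eq_zero`), the bracket
vanishes.

The identity for $F$ is the identity for $E$ in the opposite superalgebra: $t_{ij}\mapsto t_{ji}$
preserves the relations there and exchanges the two unitriangular factors. -/

namespace SuperYangian

open PowerSeries

/-! ### Inverses and triangularity for matrices of power series -/

section MatrixSeries

variable {R : Type*} [Ring R] {ι : Type*} [Fintype ι] [DecidableEq ι]

theorem coeff_zero_toSeries_eq_one_iff {M : Matrix ι ι R⟦X⟧} :
    coeff 0 (toSeries M) = 1 ↔ ∀ i j, coeff 0 (M i j) = if i = j then 1 else 0 := by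
  constructor
  · intro h i j
    rw [← coeff_toSeries, h, Matrix.one_apply]
  · intro h
    ext i j
    rw [coeff_toSeries, h, Matrix.one_apply]

theorem exists_inverse_of_coeff_zero {M : Matrix ι ι R⟦X⟧} (hM : coeff 0 (toSeries M) = 1) :
    ∃ N : Matrix ι ι R⟦X⟧, M * N = 1 ∧ N * M = 1 := by
  have h : constantCoeff (toSeries M) = ((1 : (Matrix ι ι R)ˣ) : Matrix ι ι R) := by
    rw [← coeff_zero_eq_constantCoeff_apply, hM, Units.val_one]
  have h1 : toSeries (1 : Matrix ι ι R⟦X⟧) = 1 := by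
    ext n i j
    rw [coeff_toSeries]
    rcases Nat.eq_zero_or_pos n with rfl | hn
    · simp [coeff_zero_one_apply]
    · rw [coeff_one_apply n hn, coeff_one, if_neg hn.ne', Matrix.zero_apply]
  refine ⟨ofSeries (invOfUnit (toSeries M) 1), ?_, ?_⟩ <;> apply toSeries_injective <;>
    rw [toSeries_mul, toSeries_ofSeries, h1]
  · exact mul_invOfUnit _ _ h
  · exact invOfUnit_mul _ _ h

/-- The principal submatrix of `M` on `S` has constant term $1$, so it kills no nonzero row.
Induction on the degree shows this without forming the submatrix: once the lower coefficients of `c`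
vanish, degree $n$ of the equation at `j` reads off the $n$-th coefficient of `c j`. -/
theorem row_eq_zero_of_sum_mul_eq_zero (S : ι → Prop) (M : Matrix ι ι R⟦X⟧)
    (hM : ∀ i j, coeff 0 (M i j) = if i = j then 1 else 0) (c : ι → R⟦X⟧)
    (hc : ∀ p, ¬ S p → c p = 0) (h : ∀ j, S j → ∑ p, c p * M p j = 0) (j : ι) : c j = 0 := by
  have key : ∀ n j, coeff n (c j) = 0 := by
    intro n
    induction n using Nat.strong_induction_on with
    | _ n ih =>
      intro j
      by_cases hj : S j
      · have h1 := congrArg (coeff n) (h j hj)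
        have h2 : ∀ p, coeff n (c p * M p j) = coeff n (c p) * coeff 0 (M p j) := fun p => by
          rw [coeff_mul]
          refine Finset.sum_eq_single (n, 0) ?_ (by simp)
          rintro ⟨k, l⟩ hkl hne
          rw [Finset.HasAntidiagonal.mem_antidiagonal] at hkl
          simp only at hkl
          have : k < n := by
            rcases Nat.eq_zero_or_pos l with rfl | hl
            · exact absurd (by simp_all) hne
            · omega
          simp [ih k this]
        simpa [h2, hM] using h1
      · simp [hc j hj]
  ext n
  simp [key]

theorem col_eq_zero_of_sum_mul_eq_zero (S : ι → Prop) (M : Matrix ι ι R⟦X⟧)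
    (hM : ∀ i j, coeff 0 (M i j) = if i = j then 1 else 0) (c : ι → R⟦X⟧)
    (hc : ∀ p, ¬ S p → c p = 0) (h : ∀ i, S i → ∑ p, M i p * c p = 0) (i : ι) : c i = 0 := by
  have key : ∀ n i, coeff n (c i) = 0 := by
    intro n
    induction n using Nat.strong_induction_on with
    | _ n ih =>
      intro i
      by_cases hi : S i
      · have h1 := congrArg (coeff n) (h i hi)
        have h2 : ∀ p, coeff n (M i p * c p) = coeff 0 (M i p) * coeff n (c p) := fun p => by
          rw [coeff_mul]
          refine Finset.sum_eq_single (0, n) ?_ (by simp)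
          rintro ⟨k, l⟩ hkl hne
          rw [Finset.HasAntidiagonal.mem_antidiagonal] at hkl
          simp only at hkl
          have : l < n := by
            rcases Nat.eq_zero_or_pos k with rfl | hk
            · exact absurd (by simp_all) hne
            · omega
          simp [ih l this]
        simpa [h2, hM] using h1
      · simp [hc i hi]
  ext n
  simp [key]

variable {κ : Type*} [LinearOrder κ]

/-- The factors of a block Gauss decomposition together with the inverses used to express the
entries of `E` and of `E⁻¹` through `T` and `T⁻¹`: here `V = (F D)⁻¹`, `W = F D`. -/
structure IsGaussInverse (b : ι → κ) (T E T' E' V W : Matrix ι ι R⟦X⟧) : Prop where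
  mul_inv : T * T' = 1
  inv_mul : T' * T = 1
  E_mul_inv : E * E' = 1
  E_inv_mul : E' * E = 1
  V_mul_W : V * W = 1
  W_mul_V : W * V = 1
  V_mul_T : V * T = E
  inv_mul_W : T' * W = E'
  V_lower : ∀ i j, b i < b j → V i j = 0
  W_lower : ∀ i j, b i < b j → W i j = 0

theorem IsGaussDecomposition.mul_lower {b : ι → κ} {T F D E : Matrix ι ι R⟦X⟧}
    (h : IsGaussDecomposition b T F D E) (i j : ι) (hij : b i < b j) : (F * D) i j = 0 := by
  rw [Matrix.mul_apply]
  refine Finset.sum_eq_zero fun k _ => ?_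
  by_cases hk : b k = b j
  · rw [h.lower i k (hk ▸ hij), zero_mul]
  · rw [h.diag k j hk, mul_zero]

theorem coeff_zero_toSeries_mul {A B : Matrix ι ι R⟦X⟧} (hA : coeff 0 (toSeries A) = 1)
    (hB : coeff 0 (toSeries B) = 1) : coeff 0 (toSeries (A * B)) = 1 := by
  rw [toSeries_mul, coeff_mul]
  simp [hA, hB]

theorem IsGaussDecomposition.exists_inverse {b : ι → κ} {T F D E : Matrix ι ι R⟦X⟧}
    (h : IsGaussDecomposition b T F D E) (hT : coeff 0 (toSeries T) = 1) :
    ∃ T' E' V, IsGaussInverse b T E T' E' V (F * D) := by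
  obtain ⟨hF, hD, hE⟩ := h.coeff_zero hT
  have hFD := coeff_zero_toSeries_mul hF hD
  obtain ⟨T', hT1, hT2⟩ := exists_inverse_of_coeff_zero hT
  obtain ⟨E', hE1, hE2⟩ := exists_inverse_of_coeff_zero hE
  obtain ⟨V, hV1, hV2⟩ := exists_inverse_of_coeff_zero hFD
  refine ⟨T', E', V, hT1, hT2, hE1, hE2, hV2, hV1, ?_, ?_, ?_, h.mul_lower⟩
  · rw [h.eq_mul, ← mul_assoc, hV2, one_mul]
  · have : T' * (F * D) * E = 1 := by rw [mul_assoc, ← h.eq_mul, hT2]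
    calc T' * (F * D) = T' * (F * D) * (E * E') := by rw [hE1, mul_one]
      _ = E' := by rw [← mul_assoc, this, one_mul]
  · intro i j hij
    -- Row `i` of `V` is cut down to the blocks beyond that of `i`. The discarded terms meet zero
    -- entries of the lower triangular $FD$, so the cut row is still killed by the columns of those
    -- blocks.
    have := row_eq_zero_of_sum_mul_eq_zero (fun p => b i < b p) (F * D)
      (coeff_zero_toSeries_eq_one_iff.1 hFD) (fun p => if b i < b p then V i p else 0)
      (fun p hp => if_neg hp) (fun k hk => ?_) j
    · simpa [hij] using this
    · have h1 : (V * (F * D)) i k = 0 := by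
        rw [hV2, Matrix.one_apply_ne]
        rintro rfl
        exact lt_irrefl _ hk
      rw [← h1, Matrix.mul_apply]
      refine Finset.sum_congr rfl fun p _ => ?_
      by_cases hp : b i < b p
      · rw [if_pos hp]
      · rw [h.mul_lower p k ((not_lt.1 hp).trans_lt hk), mul_zero, mul_zero]

/-- In the blocks from that of `j` on, column `j` of `E` agrees with that of the identity. Hence
column `j` of $E^{-1}-1$, cut down to these blocks, is killed by the corresponding principal
submatrix of `E`. -/
theorem IsGaussDecomposition.inverse_upper {b : ι → κ} {T F D E E' : Matrix ι ι R⟦X⟧}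
    (h : IsGaussDecomposition b T F D E) (hT : coeff 0 (toSeries T) = 1) (hE : E * E' = 1)
    (i j : ι) (hij : b j ≤ b i) : E' i j = (1 : Matrix ι ι R⟦X⟧) i j := by
  have hone : ∀ c, b j ≤ b c → E c j = (1 : Matrix ι ι R⟦X⟧) c j := fun c hc => by
    rcases hc.eq_or_lt with hc | hc
    · exact h.upper_unit c j hc.symm
    · rw [h.upper c j hc, Matrix.one_apply_ne]
      rintro rfl
      exact lt_irrefl _ hc
  have := col_eq_zero_of_sum_mul_eq_zero (fun p => b j ≤ b p) E
    (coeff_zero_toSeries_eq_one_iff.1 (h.coeff_zero hT).2.2)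
    (fun p => if b j ≤ b p then E' p j - (1 : Matrix ι ι R⟦X⟧) p j else 0)
    (fun p hp => if_neg hp) (fun c hc => ?_) i
  · simpa [hij, sub_eq_zero] using this
  · have h1 : ∑ p, E c p * (E' p j - (1 : Matrix ι ι R⟦X⟧) p j) = 0 := by
      simp only [mul_sub, Finset.sum_sub_distrib]
      rw [← Matrix.mul_apply, ← Matrix.mul_apply, hE, mul_one, hone c hc, sub_self]
    rw [← h1]
    refine Finset.sum_congr rfl fun p _ => ?_
    by_cases hp : b j ≤ b p
    · rw [if_pos hp]
    · rw [if_neg hp, h.upper c p ((not_le.1 hp).trans_le hc), zero_mul, zero_mul]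

/-- In two consecutive blocks the entries of `E` and of its inverse are opposite. -/
theorem IsGaussDecomposition.inverse_superdiagonal {b : ι → κ} {T F D E E' : Matrix ι ι R⟦X⟧}
    (h : IsGaussDecomposition b T F D E) (hT : coeff 0 (toSeries T) = 1) (hE : E * E' = 1)
    (i j : ι) (hij : b i < b j) (hcons : ∀ c, b i < b c → b j ≤ b c) : E' i j = - E i j := by
  have h1 : (E * E') i j = 0 := by
    rw [hE, Matrix.one_apply_ne]
    rintro rfl
    exact lt_irrefl _ hij
  -- No block lies strictly between those of `i` and `j`, so in every product one factor is an entry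
  -- of the identity matrix or zero. Summed over `c`, this makes $EE'$ additive at this entry.
  have h2 : ∀ c, E i c * E' c j
      = (1 : Matrix ι ι R⟦X⟧) i c * E' c j + E i c * (1 : Matrix ι ι R⟦X⟧) c j := by
    intro c
    rcases lt_trichotomy (b i) (b c) with hc | hc | hc
    · rw [h.inverse_upper hT hE c j (hcons c hc), Matrix.one_apply_ne (i := i) (j := c), zero_mul,
        zero_add]
      rintro rfl
      exact lt_irrefl _ hc
    · rw [h.upper_unit i c hc, Matrix.one_apply_ne (i := c) (j := j), mul_zero, add_zero]
      rintro rfl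
      exact hij.ne hc
    · rw [h.upper i c hc, Matrix.one_apply_ne (i := i) (j := c)]
      · simp
      · rintro rfl
        exact lt_irrefl _ hc
  rw [Matrix.mul_apply, Finset.sum_congr rfl fun c _ => h2 c, Finset.sum_add_distrib,
    ← Matrix.mul_apply, ← Matrix.mul_apply, one_mul, mul_one] at h1
  exact eq_neg_of_add_eq_zero_left h1

/-- Off the diagonal blocks the first coefficients of `T` and `E` agree. -/
theorem IsGaussDecomposition.coeff_one_upper {b : ι → κ} {T F D E : Matrix ι ι R⟦X⟧}
    (h : IsGaussDecomposition b T F D E) (hT : coeff 0 (toSeries T) = 1)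
    (i j : ι) (hij : b i < b j) : coeff 1 (E i j) = coeff 1 (T i j) := by
  obtain ⟨hF, hD, hE⟩ := h.coeff_zero hT
  have hFD := coeff_zero_toSeries_mul hF hD
  -- Both factors have constant term $1$, so first coefficients add.
  have h1 : coeff 1 (toSeries T) = coeff 1 (toSeries (F * D)) + coeff 1 (toSeries E) := by
    rw [h.eq_mul, toSeries_mul, coeff_mul, Finset.Nat.antidiagonal_succ]
    simp [hFD, hE]; simp_all [add_comm]
  have := congrFun (congrFun h1 i) j
  rw [Matrix.add_apply, coeff_toSeries, coeff_toSeries, coeff_toSeries, h.mul_lower i j hij,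
    map_zero, zero_add] at this
  exact this.symm

end MatrixSeries

/-! ### Supercommutators as twisted derivations -/

section Twisted

variable {A : Type*} [Ring A] [Algebra ℂ A]

/-- The series `x f - φ(f) x`, where `φ` acts on the coefficients of `f`. -/
noncomputable def twistedCommutator (φ : A →ₐ[ℂ] A) (x : A) (f : A⟦X⟧) : A⟦X⟧ :=
  C x * f - map (φ : A →+* A) f * C x

theorem coeff_twistedCommutator (φ : A →ₐ[ℂ] A) (x : A) (f : A⟦X⟧) (n : ℕ) :
    coeff n (twistedCommutator φ x f) = x * coeff n f - φ (coeff n f) * x := by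
  simp [twistedCommutator]

/-- The super Leibniz rule. Having `φ` in place of a sign makes it valid for all series, homogeneous
or not. -/
theorem twistedCommutator_mul (φ : A →ₐ[ℂ] A) (x : A) (f g : A⟦X⟧) :
    twistedCommutator φ x (f * g) =
      twistedCommutator φ x f * g + map (φ : A →+* A) f * twistedCommutator φ x g := by
  simp only [twistedCommutator, map_mul]
  noncomm_ring

theorem twistedCommutator_sum {ι : Type*} (s : Finset ι) (φ : A →ₐ[ℂ] A) (x : A) (f : ι → A⟦X⟧) :
    twistedCommutator φ x (∑ i ∈ s, f i) = ∑ i ∈ s, twistedCommutator φ x (f i) := by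
  simp only [twistedCommutator, map_sum, Finset.mul_sum, Finset.sum_mul, Finset.sum_sub_distrib]

theorem twistedCommutator_neg (φ : A →ₐ[ℂ] A) (x : A) (f : A⟦X⟧) :
    twistedCommutator φ x (-f) = - twistedCommutator φ x f := by
  simp only [twistedCommutator, map_neg]
  noncomm_ring

variable {ι : Type*} [DecidableEq ι]

theorem twistedCommutator_one_apply (φ : A →ₐ[ℂ] A) (x : A) (i j : ι) :
    twistedCommutator φ x ((1 : Matrix ι ι A⟦X⟧) i j) = 0 := by
  by_cases h : i = j
  · subst h; simp [twistedCommutator]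
  · simp [twistedCommutator, h]

theorem map_pow_of_homogeneous (σ : A →ₐ[ℂ] A) {y : A} {q : ℕ} (hy : σ y = (-1 : ℂ) ^ q • y)
    (p : ℕ) : (σ ^ p) y = (-1 : ℂ) ^ (p * q) • y := by
  induction p with
  | zero => simp
  | succ p ih =>
    rw [pow_succ', AlgHom.mul_apply, ih, map_smul, hy, smul_smul, ← pow_add, Nat.succ_mul]

/-- The sign $(-1)^{pq}$ is absorbed into the action of $\sigma^p$ on `y`, so the twist depends on
`x` alone. -/
theorem superBracket_eq_twisted (σ : A →ₐ[ℂ] A) {x y : A} {p q : ℕ}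
    (hx : σ x = (-1 : ℂ) ^ p • x) (hy : σ y = (-1 : ℂ) ^ q • y) :
    superBracket σ x y = x * y - (σ ^ p) y * x := by
  rw [superBracket_of_homogeneous σ hx hy, map_pow_of_homogeneous σ hy, smul_mul_assoc]

theorem superBracket_swap (σ : A →ₐ[ℂ] A) {x y : A} {p q : ℕ}
    (hx : σ x = (-1 : ℂ) ^ p • x) (hy : σ y = (-1 : ℂ) ^ q • y) :
    superBracket σ x y = -(-1 : ℂ) ^ (p * q) • superBracket σ y x := by
  rw [superBracket_of_homogeneous σ hx hy, superBracket_of_homogeneous σ hy hx, mul_comm q p,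
    smul_sub, smul_smul]
  have : -(-1 : ℂ) ^ (p * q) * (-1) ^ (p * q) = -1 := by
    rw [neg_mul, ← pow_add, ← two_mul, pow_mul]; simp
  rw [this, neg_smul, neg_smul, one_smul]
  abel

theorem superBracket_homogeneous (σ : A →ₐ[ℂ] A) {x y : A} {p q : ℕ}
    (hx : σ x = (-1 : ℂ) ^ p • x) (hy : σ y = (-1 : ℂ) ^ q • y) :
    σ (superBracket σ x y) = (-1 : ℂ) ^ (p + q) • superBracket σ x y := by
  rw [map_superBracket σ σ σ (fun _ => rfl), hx, hy, superBracket_smul_smul, pow_add]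

end Twisted

/-! ### Homogeneity of the entries of the Gauss factors -/

section Parity

variable {A : Type*} [Ring A] [Algebra ℂ A] {ι : Type*} [Fintype ι] [DecidableEq ι]

/-- The entry `(i, j)` of `M` is homogeneous of parity `|i| + |j|`. -/
def IsParityMatrix (σ : A →ₐ[ℂ] A) (par : ι → ℕ) (M : Matrix ι ι A⟦X⟧) : Prop :=
  ∀ i j n, σ (coeff n (M i j)) = (-1 : ℂ) ^ (par i + par j) • coeff n (M i j)

/-- The diagonal matrix of the signs `(-1)^|i|`. -/
noncomputable def signMatrix (par : ι → ℕ) : Matrix ι ι A⟦X⟧ :=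
  Matrix.diagonal fun i => (-1) ^ par i

omit [Algebra ℂ A] in
theorem signMatrix_mul_self (par : ι → ℕ) :
    (signMatrix par : Matrix ι ι A⟦X⟧) * signMatrix par = 1 := by
  rw [signMatrix, Matrix.diagonal_mul_diagonal, ← Matrix.diagonal_one]
  congr 1
  funext i
  rw [← pow_add, ← two_mul, pow_mul]
  simp

theorem signMatrix_conj_apply (par : ι → ℕ) (M : Matrix ι ι A⟦X⟧) (i j : ι) :
    (signMatrix par * M * signMatrix par : Matrix ι ι A⟦X⟧) i j = (-1 : ℂ) ^ (par i + par j) • M i j := by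
  rw [signMatrix, Matrix.mul_diagonal, Matrix.diagonal_mul, pow_add]
  rcases neg_one_pow_mod (par i) with h1 | h1 <;>
  rcases neg_one_pow_mod (par j) with h2 | h2 <;>
  simp [h1.1, h2.1, h1.2.neg_one_pow, h2.2.neg_one_pow]

/-- Homogeneity of all entries becomes one matrix equation $\sigma(M)=JMJ$ with $J^2=1$, visibly
stable under products and inverses. -/
theorem isParityMatrix_iff {σ : A →ₐ[ℂ] A} {par : ι → ℕ} {M : Matrix ι ι A⟦X⟧} :
    IsParityMatrix σ par M ↔
      M.map (map (σ : A →+* A)) = signMatrix par * M * signMatrix par := by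
  constructor
  · intro h
    ext i j n
    rw [signMatrix_conj_apply, Matrix.map_apply, coeff_map, RingHom.coe_coe, h i j n, coeff_smul]
  · intro h i j n
    have := congrArg (coeff n) (congrFun (congrFun h i) j)
    rwa [signMatrix_conj_apply, Matrix.map_apply, coeff_map, RingHom.coe_coe, coeff_smul] at this

variable {σ : A →ₐ[ℂ] A} {par : ι → ℕ}

omit [Algebra ℂ A] in
theorem signMatrix_conj_mul (M N : Matrix ι ι A⟦X⟧) :
    signMatrix par * (M * N) * signMatrix par =
      signMatrix par * M * signMatrix par * (signMatrix par * N * signMatrix par) := by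
  calc signMatrix par * (M * N) * signMatrix par
      = signMatrix par * M * 1 * N * signMatrix par := by simp only [mul_one, mul_assoc]
    _ = _ := by rw [← signMatrix_mul_self par]; simp only [mul_assoc]

theorem IsParityMatrix.mul {M N : Matrix ι ι A⟦X⟧} (hM : IsParityMatrix σ par M)
    (hN : IsParityMatrix σ par N) : IsParityMatrix σ par (M * N) := by
  rw [isParityMatrix_iff] at hM hN ⊢
  rw [Matrix.map_mul, hM, hN, signMatrix_conj_mul]

theorem IsParityMatrix.inverse {M N : Matrix ι ι A⟦X⟧} (hM : IsParityMatrix σ par M)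
    (h1 : M * N = 1) (h2 : N * M = 1) : IsParityMatrix σ par N := by
  rw [isParityMatrix_iff] at hM ⊢
  have e1 : (N.map (map (σ : A →+* A))) * (signMatrix par * M * signMatrix par) = 1 := by
    rw [← hM, ← Matrix.map_mul, h2, Matrix.map_one _ (map_zero _) (map_one _)]
  have e2 : (signMatrix par * M * signMatrix par) * (signMatrix par * N * signMatrix par)
      = 1 := by
    rw [← signMatrix_conj_mul, h1, mul_one, signMatrix_mul_self]
  exact left_inv_eq_right_inv e1 e2

omit [Fintype ι] [DecidableEq ι] in
theorem IsParityMatrix.map_pow {M : Matrix ι ι A⟦X⟧} (hM : IsParityMatrix σ par M) (p : ℕ)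
    (i j : ι) : map ((σ ^ p : A →ₐ[ℂ] A) : A →+* A) (M i j) =
      ((-1 : ℂ) ^ (p * par i) * (-1 : ℂ) ^ (p * par j)) • M i j := by
  ext n
  rw [coeff_map, RingHom.coe_coe, map_pow_of_homogeneous σ (hM i j n), coeff_smul, mul_add,
    pow_add]

/-- Applying $\sigma$ to the factors and conjugating them by $J$ both give Gauss decompositions of
$\sigma(T)=JTJ$; uniqueness identifies them. -/
theorem IsParityMatrix.gauss {κ : Type*} [LinearOrder κ] {b : ι → κ}
    {T F D E : Matrix ι ι A⟦X⟧} (hT : IsParityMatrix σ par T)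
    (h : IsGaussDecomposition b T F D E) (h0 : coeff 0 (toSeries T) = 1) :
    IsParityMatrix σ par F ∧ IsParityMatrix σ par D ∧ IsParityMatrix σ par E := by
  set J : Matrix ι ι A⟦X⟧ := signMatrix par with hJ
  set g := map (σ : A →+* A)
  have hone : ∀ i j, g ((1 : Matrix ι ι A⟦X⟧) i j) = (1 : Matrix ι ι A⟦X⟧) i j := fun i j => by
    by_cases hij : i = j
    · subst hij; simp
    · simp [hij]
  have hones : ∀ i j, (-1 : ℂ) ^ (par i + par j) • (1 : Matrix ι ι A⟦X⟧) i j
      = (1 : Matrix ι ι A⟦X⟧) i j := fun i j => by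
    by_cases hij : i = j
    · subst hij; simp [← two_mul]
    · simp [hij]
  have hT' := isParityMatrix_iff.1 hT
  have d1 : IsGaussDecomposition b (T.map g) (F.map g) (D.map g) (E.map g) := by
    refine ⟨by rw [h.eq_mul, Matrix.map_mul, Matrix.map_mul], ?_, ?_, ?_, ?_, ?_, ?_, ?_⟩ <;>
      intro i j hij <;> rw [Matrix.map_apply]
    · rw [h.diag i j hij, map_zero]
    · rw [h.lower i j hij, map_zero]
    · rw [h.lower_unit i j hij, hone]
    · rw [coeff_map, h.lower_coeff i j hij, map_zero]
    · rw [h.upper i j hij, map_zero]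
    · rw [h.upper_unit i j hij, hone]
    · rw [coeff_map, h.upper_coeff i j hij, map_zero]
  have d2 : IsGaussDecomposition b (T.map g) (J * F * J) (J * D * J) (J * E * J) := by
    refine ⟨by rw [hT', h.eq_mul, signMatrix_conj_mul, signMatrix_conj_mul],
      ?_, ?_, ?_, ?_, ?_, ?_, ?_⟩ <;>
      intro i j hij <;> rw [signMatrix_conj_apply]
    · rw [h.diag i j hij, smul_zero]
    · rw [h.lower i j hij, smul_zero]
    · rw [h.lower_unit i j hij, hones]
    · rw [coeff_smul, h.lower_coeff i j hij, smul_zero]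
    · rw [h.upper i j hij, smul_zero]
    · rw [h.upper_unit i j hij, hones]
    · rw [coeff_smul, h.upper_coeff i j hij, smul_zero]
  have h0' : coeff 0 (toSeries (T.map g)) = 1 := by
    rw [coeff_zero_toSeries_eq_one_iff] at h0 ⊢
    intro i j
    rw [Matrix.map_apply, coeff_map, h0]
    split <;> simp
  have := (existsUnique_gauss b (T.map g) h0').unique (y₁ := (F.map g, D.map g, E.map g))
    (y₂ := (J * F * J, J * D * J, J * E * J)) d1 d2
  simp only [Prod.mk.injEq] at this
  exact ⟨isParityMatrix_iff.2 this.1, isParityMatrix_iff.2 this.2.1,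
    isParityMatrix_iff.2 this.2.2⟩

end Parity

/-! ### Commutators of the generators with the entries of $T$ and $T^{-1}$ -/

section RTT

variable {A : Type*} [Ring A] [Algebra ℂ A] {ι : Type*} [DecidableEq ι]

/-- Elements `t_{ij}^{(r)}` of a superalgebra with the relations of the super Yangian, written
without sums. -/
structure IsSuperRTT (σ : A →ₐ[ℂ] A) (par : ι → ℕ) (t : ι → ι → ℕ → A) : Prop where
  zero : ∀ i j, t i j 0 = if i = j then 1 else 0
  parity : ∀ i j r, σ (t i j r) = (-1 : ℂ) ^ (par i + par j) • t i j r
  comm : ∀ i j h k r s,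
    superBracket σ (t i j (r + 1)) (t h k s) - superBracket σ (t i j r) (t h k (s + 1)) =
      (-1 : ℂ) ^ (par i * par j + par i * par h + par j * par h) •
        (t h j r * t i k s - t h j s * t i k r)

/-- The matrix of the series `∑_r t_{ij}^{(r)} X^r`. -/
noncomputable def seriesMatrix (t : ι → ι → ℕ → A) : Matrix ι ι A⟦X⟧ :=
  Matrix.of fun i j => PowerSeries.mk (t i j)

omit [Algebra ℂ A] [DecidableEq ι] in
theorem coeff_seriesMatrix (t : ι → ι → ℕ → A) (i j : ι) (n : ℕ) :
    coeff n (seriesMatrix t i j) = t i j n := by simp [seriesMatrix]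

namespace IsSuperRTT

variable {σ : A →ₐ[ℂ] A} {par : ι → ℕ} {t : ι → ι → ℕ → A}

theorem isParityMatrix (ht : IsSuperRTT σ par t) : IsParityMatrix σ par (seriesMatrix t) :=
  fun i j n => by rw [coeff_seriesMatrix, ht.parity]

theorem coeff_zero (ht : IsSuperRTT σ par t) (i j : ι) :
    coeff 0 (seriesMatrix t i j) = if i = j then 1 else 0 := by
  rw [coeff_seriesMatrix, ht.zero]

/-- The element $t_{ij}^{(0)}$ is $0$ or $1$; when it is $1$, the exponent $|i|+|j|=2|i|$ is even
and the twist is trivial. -/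
theorem twistedCommutator_zero (ht : IsSuperRTT σ par t) {M : Matrix ι ι A⟦X⟧}
    (hM : IsParityMatrix σ par M) (i j a c : ι) :
    twistedCommutator (σ ^ (par i + par j)) (t i j 0) (M a c) = 0 := by
  rw [ht.zero]
  by_cases h : i = j
  · subst h
    rw [twistedCommutator, hM.map_pow, ← two_mul]
    simp [mul_assoc, pow_mul]
  · simp [h, twistedCommutator]

/-- This packs `comm` for all $s$ into one identity of series. The sign is split so that its
dependence on `h` is the character $(-1)^{(|i|+|j|)|h|}$, which is also the one through which the
twist acts on entries. -/
theorem twistedCommutator_shift (ht : IsSuperRTT σ par t) (i j h k : ι) (r : ℕ) :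
    twistedCommutator (σ ^ (par i + par j)) (t i j r) (seriesMatrix t h k) =
      (twistedCommutator (σ ^ (par i + par j)) (t i j (r + 1)) (seriesMatrix t h k)
        - ((-1 : ℂ) ^ (par i * par j) * (-1 : ℂ) ^ ((par i + par j) * par h)) •
          (C (t h j r) * seriesMatrix t i k - seriesMatrix t h j * C (t i k r))) * X := by
  have hb : ∀ r s, superBracket σ (t i j r) (t h k s) =
      coeff s (twistedCommutator (σ ^ (par i + par j)) (t i j r) (seriesMatrix t h k)) :=
    fun r s => by
      rw [coeff_twistedCommutator, coeff_seriesMatrix,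
        superBracket_eq_twisted σ (ht.parity i j r) (ht.parity h k s)]
  ext n
  cases n with
  | zero =>
    rw [coeff_zero_mul_X, coeff_twistedCommutator, coeff_seriesMatrix, ht.zero]
    split <;> simp
  | succ n =>
    have := ht.comm i j h k r n
    rw [hb, hb] at this
    rw [coeff_succ_mul_X, map_sub, coeff_smul, map_sub, coeff_C_mul, coeff_mul_C,
      coeff_seriesMatrix, coeff_seriesMatrix, ← pow_add, show par i * par j + (par i + par j) * par h
      = par i * par j + par i * par h + par j * par h by ring, ← this]
    abel

variable [Fintype ι] {T' : Matrix ι ι A⟦X⟧}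

/-- The commutator of `t_{ij}^{(r)}` with the entries of `T⁻¹`. -/
theorem twistedCommutator_inverse_shift (ht : IsSuperRTT σ par t)
    (h1 : seriesMatrix t * T' = 1) (h2 : T' * seriesMatrix t = 1) (i j a c : ι) (r : ℕ) :
    twistedCommutator (σ ^ (par i + par j)) (t i j r) (T' a c) =
      (twistedCommutator (σ ^ (par i + par j)) (t i j (r + 1)) (T' a c)
        + ((-1 : ℂ) ^ (par i * par j) * (-1 : ℂ) ^ ((par i + par j) * par a)) •
          ((∑ h, T' a h * C (t h j r)) * (1 : Matrix ι ι A⟦X⟧) i c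
            - (1 : Matrix ι ι A⟦X⟧) a j * ∑ k, C (t i k r) * T' k c)) * X := by
  set p := par i + par j with hp
  set S := seriesMatrix t with hS
  set κ : ℂ := (-1 : ℂ) ^ (par i * par j)
  set χ : ι → ℂ := fun a => (-1 : ℂ) ^ (p * par a) with hχ
  have hχχ : ∀ a, χ a * χ a = 1 := fun a => by
    rw [hχ, ← pow_add, ← two_mul, pow_mul]; simp
  set φ := σ ^ p with hφ
  have hT' : ∀ a h, map (φ : A →+* A) (T' a h) = (χ a * χ h) • T' a h :=
    (ht.isParityMatrix.inverse h1 h2).map_pow p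
  -- The derivative of an inverse: applying the twisted Leibniz rule to $TT'=1$ gives
  -- $\delta(T')=-\varphi(T')\,\delta(T)\,T'$.
  have hconj : ∀ x, twistedCommutator φ x (T' a c) =
      - ∑ h, ∑ k, map (φ : A →+* A) (T' a h) * twistedCommutator φ x (S h k) * T' k c := by
    intro x
    have e1 : ∀ h, ∑ k, (twistedCommutator φ x (S h k) * T' k c
        + map (φ : A →+* A) (S h k) * twistedCommutator φ x (T' k c)) = 0 := fun h => by
      rw [← twistedCommutator_one_apply φ x h c, ← h1, Matrix.mul_apply, twistedCommutator_sum]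
      simp only [twistedCommutator_mul]
    have e2 : ∑ h, map (φ : A →+* A) (T' a h) * ∑ k, map (φ : A →+* A) (S h k) *
        twistedCommutator φ x (T' k c) = twistedCommutator φ x (T' a c) := by
      have e3 : ∀ k, ∑ h, map (φ : A →+* A) (T' a h) * map (φ : A →+* A) (S h k)
          = (1 : Matrix ι ι A⟦X⟧) a k := fun k => by
        simp only [← map_mul]
        rw [← map_sum, ← Matrix.mul_apply, h2]
        by_cases hak : a = k
        · subst hak; simp
        · simp [hak]
      simp only [Finset.mul_sum, ← mul_assoc]
      rw [Finset.sum_comm]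
      simp only [← Finset.sum_mul, e3, Matrix.one_apply, ite_mul, one_mul, zero_mul,
        Finset.sum_ite_eq, Finset.mem_univ, if_true]
    rw [← e2, ← Finset.sum_neg_distrib]
    refine Finset.sum_congr rfl fun h _ => ?_
    have := e1 h
    rw [Finset.sum_add_distrib, add_comm] at this
    rw [eq_neg_of_add_eq_zero_left this, mul_neg, Finset.mul_sum]
    simp only [mul_assoc]
  have hX : ∀ f : A⟦X⟧, f * X = X * f := fun f => (commute_X f).eq
  have hsum : ∑ h, ∑ k, map (φ : A →+* A) (T' a h) *
      ((κ * χ h) • (C (t h j r) * S i k - S h j * C (t i k r))) * T' k c =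
      (κ * χ a) • ((∑ h, T' a h * C (t h j r)) * (1 : Matrix ι ι A⟦X⟧) i c
            - (1 : Matrix ι ι A⟦X⟧) a j * ∑ k, C (t i k r) * T' k c) := by
    -- Expanding the identity entries as $ST'$ and $T'S$ turns both sides into double sums that
    -- agree termwise; the factor $\chi(h)$ appears twice and cancels.
    have e1 : (1 : Matrix ι ι A⟦X⟧) i c = ∑ k, S i k * T' k c := by rw [← h1, Matrix.mul_apply]
    have e2 : (1 : Matrix ι ι A⟦X⟧) a j = ∑ h, T' a h * S h j := by rw [← h2, Matrix.mul_apply]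
    rw [e1, e2, Finset.sum_mul_sum, Finset.sum_mul_sum,
      ← Finset.sum_sub_distrib, Finset.smul_sum]
    refine Finset.sum_congr rfl fun h _ => ?_
    rw [← Finset.sum_sub_distrib, Finset.smul_sum]
    refine Finset.sum_congr rfl fun k _ => ?_
    rw [hT', smul_mul_smul_comm, smul_mul_assoc,
      show χ a * χ h * (κ * χ h) = κ * χ a * (χ h * χ h) by ring, hχχ, mul_one]
    congr 1
    noncomm_ring
  rw [hconj, hconj, ← hsum, neg_add_eq_sub, ← Finset.sum_sub_distrib, Finset.sum_mul,
    ← Finset.sum_neg_distrib]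
  refine Finset.sum_congr rfl fun h _ => ?_
  rw [← Finset.sum_sub_distrib, Finset.sum_mul, ← Finset.sum_neg_distrib]
  refine Finset.sum_congr rfl fun k _ => ?_
  have hs : twistedCommutator φ (t i j r) (S h k) = (twistedCommutator φ (t i j (r + 1)) (S h k)
      - (κ * χ h) • (C (t h j r) * S i k - S h j * C (t i k r))) * X :=
    ht.twistedCommutator_shift i j h k r
  rw [hs, hX, hX (_ - _)]
  generalize (κ * χ h) • (C (t h j r) * S i k - S h j * C (t i k r)) = g
  rw [← mul_assoc, hX]
  simp only [mul_assoc, mul_sub, sub_mul, neg_sub]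

/-- With both Kronecker deltas zero, the recursion says that the commutator for $r$ is $X$ times the
one for $r+1$. It is thus divisible by every power of $X$; the induction on the degree has to run
over all $r$ at once. -/
theorem twistedCommutator_inverse_eq_zero (ht : IsSuperRTT σ par t)
    (h1 : seriesMatrix t * T' = 1) (h2 : T' * seriesMatrix t = 1) {i j a c : ι} (hic : i ≠ c)
    (haj : a ≠ j) (r : ℕ) :
    twistedCommutator (σ ^ (par i + par j)) (t i j r) (T' a c) = 0 := by
  have key : ∀ n r, coeff n (twistedCommutator (σ ^ (par i + par j)) (t i j r) (T' a c)) = 0 := by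
    intro n
    induction n with
    | zero =>
      intro r
      rw [ht.twistedCommutator_inverse_shift h1 h2, coeff_zero_mul_X]
    | succ n ih =>
      intro r
      rw [ht.twistedCommutator_inverse_shift h1 h2, coeff_succ_mul_X, map_add, ih, zero_add,
        Matrix.one_apply_ne hic, Matrix.one_apply_ne haj]
      simp
  ext n
  rw [key, map_zero]

-- The case $r=0$ of the recursion: its left side vanishes because $t_{ij}^{(0)}$ is a scalar, and
-- the factor $X$ cancels. The result is the matrix-unit action of $t_{ij}^{(1)}$ on $T$.
omit [Fintype ι] in
theorem twistedCommutator_one (ht : IsSuperRTT σ par t) (i j h k : ι) :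
    twistedCommutator (σ ^ (par i + par j)) (t i j 1) (seriesMatrix t h k) =
      ((-1 : ℂ) ^ (par i * par j) * (-1 : ℂ) ^ ((par i + par j) * par h)) •
        ((1 : Matrix ι ι A⟦X⟧) h j * seriesMatrix t i k
          - seriesMatrix t h j * (1 : Matrix ι ι A⟦X⟧) i k) := by
  have hC : ∀ i j, (C (t i j 0) : A⟦X⟧) = (1 : Matrix ι ι A⟦X⟧) i j := fun i j => by
    rw [ht.zero, Matrix.one_apply]; split <;> simp
  have := ht.twistedCommutator_shift i j h k 0
  rw [ht.twistedCommutator_zero ht.isParityMatrix, hC, hC] at this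
  ext n
  have := congrArg (coeff (n + 1)) this
  rw [coeff_succ_mul_X, map_zero, map_sub, eq_comm, sub_eq_zero] at this
  exact this

theorem twistedCommutator_inverse_one (ht : IsSuperRTT σ par t)
    (h1 : seriesMatrix t * T' = 1) (h2 : T' * seriesMatrix t = 1) (i j a c : ι) :
    twistedCommutator (σ ^ (par i + par j)) (t i j 1) (T' a c) =
      ((-1 : ℂ) ^ (par i * par j) * (-1 : ℂ) ^ ((par i + par j) * par a)) •
        ((1 : Matrix ι ι A⟦X⟧) a j * T' i c - T' a j * (1 : Matrix ι ι A⟦X⟧) i c) := by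
  have hC : ∀ i j, (C (t i j 0) : A⟦X⟧) = (1 : Matrix ι ι A⟦X⟧) i j := fun i j => by
    rw [ht.zero, Matrix.one_apply]; split <;> simp
  have := ht.twistedCommutator_inverse_shift h1 h2 i j a c 0
  simp only [ht.twistedCommutator_zero (ht.isParityMatrix.inverse h1 h2), hC] at this
  rw [← Matrix.mul_apply, ← Matrix.mul_apply, mul_one, one_mul] at this
  ext n
  have := congrArg (coeff (n + 1)) this
  rw [coeff_succ_mul_X, map_zero, map_add, eq_comm, add_eq_zero_iff_eq_neg, ← map_neg,
    ← smul_neg, neg_sub] at this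
  exact this

end IsSuperRTT

end RTT

/-! ### Brackets of entries of $E$ and $E^{-1}$ -/

section Derivations

variable {A : Type*} [Ring A] [Algebra ℂ A] {ι : Type*} [Fintype ι] [DecidableEq ι]
  {κ : Type*} [LinearOrder κ] {b : ι → κ} {T F D E T' E' V W : Matrix ι ι A⟦X⟧}

omit [Algebra ℂ A] in
theorem IsGaussInverse.coeff_zero_inverse (H : IsGaussInverse b T E T' E' V W)
    (hT : coeff 0 (toSeries T) = 1) : coeff 0 (toSeries T') = 1 := by
  have h3 : coeff 0 (toSeries (T * T')) = coeff 0 (toSeries T) * coeff 0 (toSeries T') := by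
    rw [toSeries_mul, coeff_mul]
    simp
  rw [hT, one_mul, H.mul_inv] at h3
  rw [← h3]
  ext i j
  rw [coeff_toSeries, coeff_zero_one_apply]

theorem twistedCommutator_zero_right (φ : A →ₐ[ℂ] A) (x : A) : twistedCommutator φ x 0 = 0 := by
  simp [twistedCommutator]

/-- Row `i` of `V` is determined by the entries of `T` in the blocks up to that of `i`. If `y`
twisted-commutes with these, it does so with the row, and only the factor `T` in $E=VT$ is
differentiated. -/
theorem IsGaussInverse.twistedCommutator_E (H : IsGaussInverse b T E T' E' V W)
    (hg : IsGaussDecomposition b T F D E) (hT : coeff 0 (toSeries T) = 1)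
    (φ : A →ₐ[ℂ] A) (y : A) (i : ι)
    (hy : ∀ p q, b p ≤ b i → b q ≤ b i → twistedCommutator φ y (T p q) = 0) (j : ι) :
    twistedCommutator φ y (E i j) =
      ∑ p, map (φ : A →+* A) (V i p) * twistedCommutator φ y (T p j) := by
  have hsum : ∀ j, twistedCommutator φ y (E i j) = ∑ p, twistedCommutator φ y (V i p) * T p j +
      ∑ p, map (φ : A →+* A) (V i p) * twistedCommutator φ y (T p j) := fun j => by
    rw [← H.V_mul_T, Matrix.mul_apply, twistedCommutator_sum, ← Finset.sum_add_distrib]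
    simp only [twistedCommutator_mul]
  have hV := row_eq_zero_of_sum_mul_eq_zero (fun p => b p ≤ b i) T
    -- In the columns up to the block of `i`, row `i` of `E` is that of the identity, so
    -- differentiating $E=VT$ there shows that this row is killed by `T`.
    (coeff_zero_toSeries_eq_one_iff.1 hT) (fun p => twistedCommutator φ y (V i p))
    (fun p hp => by rw [H.V_lower i p (not_le.1 hp), twistedCommutator_zero_right])
    (fun j hj => by
      have h1 : E i j = (1 : Matrix ι ι A⟦X⟧) i j := by
        rcases hj.eq_or_lt with hj | hj
        · exact hg.upper_unit i j hj.symm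
        · rw [hg.upper i j hj, Matrix.one_apply_ne]
          rintro rfl
          exact lt_irrefl _ hj
      have h2 := hsum j
      have h3 : ∑ p, map (φ : A →+* A) (V i p) * twistedCommutator φ y (T p j) = 0 :=
        Finset.sum_eq_zero fun p _ => by
          by_cases hp : b p ≤ b i
          · rw [hy p j hp hj, mul_zero]
          · rw [H.V_lower i p (not_le.1 hp), map_zero, zero_mul]
      rw [h1, twistedCommutator_one_apply, h3, add_zero] at h2
      exact h2.symm)
  rw [hsum, Finset.sum_eq_zero (fun p _ => by rw [hV, zero_mul]), zero_add]

/-- The mirror image for $E^{-1}=T^{-1}W$: column `j` of `W` is governed by the entries of $T^{-1}$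
in the blocks from that of `j` on. -/
theorem IsGaussInverse.twistedCommutator_inverse (H : IsGaussInverse b T E T' E' V W)
    (hg : IsGaussDecomposition b T F D E) (hT : coeff 0 (toSeries T) = 1)
    (φ : A →ₐ[ℂ] A) (y : A) (j : ι)
    (hy : ∀ p q, b j ≤ b p → b j ≤ b q → twistedCommutator φ y (T' p q) = 0) (i : ι) :
    twistedCommutator φ y (E' i j) = ∑ q, twistedCommutator φ y (T' i q) * W q j := by
  have hsum : ∀ i, twistedCommutator φ y (E' i j) = ∑ q, twistedCommutator φ y (T' i q) * W q j +
      ∑ q, (T'.map (map (φ : A →+* A))) i q * twistedCommutator φ y (W q j) := fun i => by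
    rw [← H.inv_mul_W, Matrix.mul_apply, twistedCommutator_sum, ← Finset.sum_add_distrib]
    simp only [twistedCommutator_mul, Matrix.map_apply]
  have hW := col_eq_zero_of_sum_mul_eq_zero (fun q => b j ≤ b q) (T'.map (map (φ : A →+* A)))
    (fun i j => by
      rw [Matrix.map_apply, coeff_map,
        coeff_zero_toSeries_eq_one_iff.1 (H.coeff_zero_inverse hT) i j]
      split <;> simp)
    (fun q => twistedCommutator φ y (W q j))
    (fun q hq => by rw [H.W_lower q j (not_le.1 hq), twistedCommutator_zero_right])
    (fun i hi => by
      have h2 := hsum i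
      rw [hg.inverse_upper hT H.E_mul_inv i j hi, twistedCommutator_one_apply,
        Finset.sum_eq_zero (fun q _ => ?_), zero_add] at h2
      · exact h2.symm
      · by_cases hq : b j ≤ b q
        · rw [hy i q hi hq, zero_mul]
        · rw [H.W_lower q j (not_le.1 hq), mul_zero])
  rw [hsum, add_eq_left]
  exact Finset.sum_eq_zero fun q _ => by rw [hW, mul_zero]

namespace IsSuperRTT

variable {σ : A →ₐ[ℂ] A} {par : ι → ℕ} {t : ι → ι → ℕ → A}

theorem coeff_zero_toSeries (ht : IsSuperRTT σ par t) :
    coeff 0 (toSeries (seriesMatrix t)) = 1 :=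
  coeff_zero_toSeries_eq_one_iff.2 ht.coeff_zero

/-- In $E_{ij}=\sum_q V_{iq}T_{qj}$ only $T_{qj}$ is moved by $t_{hk}^{(1)}$, and for `q` up to the
block of `i` it becomes $\pm\delta_{hj}T_{qk}$. The scalar is a sign if $h=j$ and zero otherwise. -/
theorem exists_superBracket_E (ht : IsSuperRTT σ par t)
    (hg : IsGaussDecomposition b (seriesMatrix t) F D E) {i h k : ι} (j : ι) (r : ℕ)
    (hih : b i < b h) (hhk : b h < b k) :
    ∃ c : ℂ, superBracket σ (coeff r (E i j)) (coeff 1 (E h k)) = c • coeff r (E i k) := by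
  have hT := ht.coeff_zero_toSeries
  obtain ⟨T', E', V, H⟩ := hg.exists_inverse hT
  obtain ⟨hpF, hpD, hpE⟩ := ht.isParityMatrix.gauss hg hT
  have hpV : IsParityMatrix σ par V :=
    (hpF.mul hpD).inverse H.W_mul_V H.V_mul_W
  set S := seriesMatrix t with hS
  set p := par h + par k with hp
  have key : twistedCommutator (σ ^ p) (t h k 1) (E i j) =
      (-(-1 : ℂ) ^ (par h * par k) * (-1 : ℂ) ^ (p * par i)) •
        (E i k * (1 : Matrix ι ι A⟦X⟧) h j) := by
    rw [H.twistedCommutator_E hg hT]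
    · rw [← H.V_mul_T, Matrix.mul_apply, Finset.sum_mul, Finset.smul_sum]
      refine Finset.sum_congr rfl fun q _ => ?_
      by_cases hq : b i < b q
      · simp [H.V_lower i q hq]
      · rw [ht.twistedCommutator_one, hpV.map_pow, Matrix.one_apply_ne (i := q) (j := k)]
        -- The sign depending on `q` arises once from the twist on `V i q` and once from the
        -- commutator with `T q j`; its cancellation lets the sum collapse to $VT$.
        · have hsq : (-1 : ℂ) ^ (p * par q) * (-1) ^ (p * par q) = 1 := by
            rw [← pow_add, ← two_mul, pow_mul]; simp
          rw [smul_mul_smul_comm, zero_mul, zero_sub, mul_neg, smul_neg, ← neg_smul, mul_assoc]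
          congr 1
          · linear_combination (-(-1 : ℂ) ^ (p * par i) * (-1) ^ (par h * par k)) * hsq
          · exact (mul_assoc _ _ _).symm
        · rintro rfl
          exact hq (hih.trans hhk)
    · intro a c ha hc
      rw [ht.twistedCommutator_one, Matrix.one_apply_ne (i := a) (j := k),
        Matrix.one_apply_ne (i := h) (j := c)]
      · simp
      · rintro rfl
        exact absurd hih hc.not_gt
      · rintro rfl
        exact absurd (hih.trans hhk) ha.not_gt
  have h1 : coeff 1 (E h k) = t h k 1 := by
    rw [hg.coeff_one_upper hT h k hhk, coeff_seriesMatrix]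
  rw [h1, superBracket_swap σ (hpE i j r) (ht.parity h k 1),
    superBracket_eq_twisted σ (ht.parity h k 1) (hpE i j r), ← coeff_twistedCommutator, key,
    coeff_smul, smul_smul]
  by_cases hhj : h = j
  · subst hhj
    exact ⟨_, by rw [Matrix.one_apply_eq, mul_one]⟩
  · exact ⟨0, by simp [hhj]⟩

/-- Trading $E_{fg}$ for $-(E^{-1})_{fg}$ makes the answer an entry of $E^{-1}$, which is built from
the far end of $T^{-1}$ and so supercommutes with the early entries of `T`. -/
theorem exists_superBracket_inverse (ht : IsSuperRTT σ par t)
    (hg : IsGaussDecomposition b (seriesMatrix t) F D E) {T' E' V W : Matrix ι ι A⟦X⟧}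
    (H : IsGaussInverse b (seriesMatrix t) E T' E' V W) {h k g : ι} (f : ι) (s : ℕ)
    (hhk : b h < b k) (hkg : b k < b g) (hfg : b f < b g) (hcons : ∀ c, b f < b c → b g ≤ b c) :
    ∃ c : ℂ, superBracket σ (coeff 1 (E h k)) (coeff s (E f g)) = c • coeff s (E' h g) := by
  have hT := ht.coeff_zero_toSeries
  obtain ⟨hpF, hpD, hpE⟩ := ht.isParityMatrix.gauss hg hT
  set S := seriesMatrix t with hS
  set p := par h + par k with hp
  have key : twistedCommutator (σ ^ p) (t h k 1) (E' f g) =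
      ((-1 : ℂ) ^ (par h * par k) * (-1 : ℂ) ^ (p * par f)) •
        ((1 : Matrix ι ι A⟦X⟧) f k * E' h g) := by
    rw [H.twistedCommutator_inverse hg hT]
    · rw [← H.inv_mul_W, Matrix.mul_apply, Finset.mul_sum, Finset.smul_sum]
      refine Finset.sum_congr rfl fun q _ => ?_
      by_cases hq : b q < b g
      · simp [H.W_lower q g hq]
      · rw [ht.twistedCommutator_inverse_one H.mul_inv H.inv_mul,
          Matrix.one_apply_ne (i := h) (j := q), mul_zero, sub_zero, smul_mul_assoc, mul_assoc]
        rintro rfl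
        exact hq (hhk.trans hkg)
    · intro a c ha hc
      rw [ht.twistedCommutator_inverse_one H.mul_inv H.inv_mul,
        Matrix.one_apply_ne (i := a) (j := k), Matrix.one_apply_ne (i := h) (j := c)]
      · simp
      · rintro rfl
        exact absurd (hhk.trans hkg) hc.not_gt
      · rintro rfl
        exact absurd hkg ha.not_gt
  have h1 : coeff 1 (E h k) = t h k 1 := by
    rw [hg.coeff_one_upper hT h k hhk, coeff_seriesMatrix]
  have h2 : E f g = - E' f g := by
    rw [hg.inverse_superdiagonal hT H.E_mul_inv f g hfg hcons, neg_neg]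
  rw [h1, superBracket_eq_twisted σ (ht.parity h k 1) (hpE f g s), ← coeff_twistedCommutator, h2,
    twistedCommutator_neg, key, ← neg_smul, coeff_smul]
  by_cases hfk : f = k
  · subst hfk
    exact ⟨_, by rw [Matrix.one_apply_eq, one_mul]⟩
  · exact ⟨0, by simp [hfk]⟩

/-- Two applications of the derivation lemmas: the $t_{pq}$ entering $E_{ik}$ annihilate
$(E^{-1})_{hg}=\sum_c (T^{-1})_{hc}W_{cg}$, and then $(E^{-1})_{hg}$, acting as a derivation,
annihilates $E_{ik}=\sum_p V_{ip}T_{pk}$. -/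
theorem superBracket_E_inverse (ht : IsSuperRTT σ par t)
    (hg : IsGaussDecomposition b (seriesMatrix t) F D E) {T' E' V W : Matrix ι ι A⟦X⟧}
    (H : IsGaussInverse b (seriesMatrix t) E T' E' V W) {i h k g : ι} (r s : ℕ)
    (hih : b i < b h) (hhk : b h < b k) (hkg : b k < b g) :
    superBracket σ (coeff r (E i k)) (coeff s (E' h g)) = 0 := by
  have hT := ht.coeff_zero_toSeries
  obtain ⟨hpF, hpD, hpE⟩ := ht.isParityMatrix.gauss hg hT
  have hpE' := hpE.inverse H.E_mul_inv H.E_inv_mul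
  set S := seriesMatrix t with hS
  have key : ∀ p q n, b p ≤ b i → (b q ≤ b i ∨ q = k) →
      superBracket σ (t p q n) (coeff s (E' h g)) = 0 := by
    intro p q n hp hq
    have hqh : h ≠ q := by
      rintro rfl
      rcases hq with hq | rfl
      · exact absurd hih hq.not_gt
      · exact lt_irrefl _ hhk
    have hqg : b q < b g := by
      rcases hq with hq | rfl
      · exact hq.trans_lt (hih.trans (hhk.trans hkg))
      · exact hkg
    have hpg : b p < b g := hp.trans_lt (hih.trans (hhk.trans hkg))
    have hne : ∀ c, b g ≤ b c → p ≠ c := by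
      rintro c hc rfl
      exact absurd hpg hc.not_gt
    rw [superBracket_eq_twisted σ (ht.parity p q n) (hpE' h g s), ← coeff_twistedCommutator,
      H.twistedCommutator_inverse hg hT, Finset.sum_eq_zero, map_zero]
    · intro c _
      by_cases hc : b g ≤ b c
      · rw [ht.twistedCommutator_inverse_eq_zero H.mul_inv H.inv_mul (hne c hc) hqh, zero_mul]
      · rw [H.W_lower c g (not_le.1 hc), mul_zero]
    · intro a c ha hc
      refine ht.twistedCommutator_inverse_eq_zero H.mul_inv H.inv_mul (hne c hc) ?_ n
      rintro rfl
      exact absurd hqg ha.not_gt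
  have key2 : ∀ p q, b p ≤ b i → (b q ≤ b i ∨ q = k) →
      twistedCommutator (σ ^ (par h + par g)) (coeff s (E' h g)) (S p q) = 0 := by
    intro p q hp hq
    ext n
    rw [coeff_twistedCommutator, coeff_seriesMatrix,
      ← superBracket_eq_twisted σ (hpE' h g s) (ht.parity p q n),
      superBracket_swap σ (hpE' h g s) (ht.parity p q n), key p q n hp hq, smul_zero, map_zero]
  rw [superBracket_swap σ (hpE i k r) (hpE' h g s),
    superBracket_eq_twisted σ (hpE' h g s) (hpE i k r), ← coeff_twistedCommutator,
    H.twistedCommutator_E hg hT _ _ i (fun p q hp hq => key2 p q hp (Or.inl hq)),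
    Finset.sum_eq_zero, map_zero, smul_zero]
  intro p _
  by_cases hp : b p ≤ b i
  · rw [key2 p k hp (Or.inr rfl), mul_zero]
  · rw [H.V_lower i p (not_le.1 hp), map_zero, zero_mul]

/-- The quartic Serre relation. -/
theorem superBracket_superBracket_eq_zero (ht : IsSuperRTT σ par t)
    (hg : IsGaussDecomposition b (seriesMatrix t) F D E) {i h h₀ k k₀ g : ι} (j f : ι) (r s : ℕ)
    (hih : b i < b h) (hh : b h₀ = b h) (hhk : b h < b k) (hk : b k₀ = b k) (hfk : b f = b k)
    (hkg : b k < b g) (hcons : ∀ c, b k < b c → b g ≤ b c) :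
    superBracket σ (superBracket σ (coeff r (E i j)) (coeff 1 (E h k)))
      (superBracket σ (coeff 1 (E h₀ k₀)) (coeff s (E f g))) = 0 := by
  obtain ⟨T', E', V, H⟩ := hg.exists_inverse ht.coeff_zero_toSeries
  obtain ⟨c, hc⟩ := ht.exists_superBracket_E hg j r hih hhk
  obtain ⟨d, hd⟩ := ht.exists_superBracket_inverse hg H f s (h := h₀) (k := k₀) (g := g)
    (by rw [hh, hk]; exact hhk) (by rw [hk]; exact hkg) (by rw [hfk]; exact hkg)
    (by rw [hfk]; exact hcons)
  rw [hc, hd, superBracket_smul_smul, ht.superBracket_E_inverse hg H r s (hh ▸ hih)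
    (hh ▸ hhk) hkg, smul_zero]

end IsSuperRTT

end Derivations

/-! ### Passage to the opposite superalgebra, exchanging $E$ and $F$ -/

open MulOpposite

section Opposite

variable {A : Type*} [Ring A] [Algebra ℂ A]

theorem homogeneous_op {σ : A →ₐ[ℂ] A} {x : A} {p : ℕ} (hx : σ x = (-1 : ℂ) ^ p • x) :
    AlgHom.op σ (op x) = (-1 : ℂ) ^ p • op x := by
  rw [← op_smul, ← hx]
  rfl

/-- Reversing products changes the bracket of homogeneous elements only by a nonzero scalar, so
vanishing of iterated brackets can be tested in the opposite algebra. -/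
theorem superBracket_op {σ : A →ₐ[ℂ] A} {x y : A} {p q : ℕ}
    (hx : σ x = (-1 : ℂ) ^ p • x) (hy : σ y = (-1 : ℂ) ^ q • y) :
    superBracket (AlgHom.op σ) (op x) (op y) =
      -(-1 : ℂ) ^ (p * q) • op (superBracket σ x y) := by
  rw [superBracket_swap σ hx hy, op_smul, smul_smul,
    superBracket_of_homogeneous σ hy hx,
    superBracket_of_homogeneous _ (homogeneous_op hx) (homogeneous_op hy), mul_comm q p]
  have : -(-1 : ℂ) ^ (p * q) * -(-1) ^ (p * q) = 1 := by
    rw [neg_mul_neg, ← pow_add, ← two_mul, pow_mul]; simp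
  rw [this, one_smul, op_sub, op_smul, op_mul, op_mul]

theorem superBracket_eq_zero_of_op {σ : A →ₐ[ℂ] A} {x y z w : A} {p q p' q' : ℕ}
    (hx : σ x = (-1 : ℂ) ^ p • x) (hy : σ y = (-1 : ℂ) ^ q • y)
    (hz : σ z = (-1 : ℂ) ^ p' • z) (hw : σ w = (-1 : ℂ) ^ q' • w)
    (h : superBracket (AlgHom.op σ) (superBracket (AlgHom.op σ) (op x) (op y))
      (superBracket (AlgHom.op σ) (op z) (op w)) = 0) :
    superBracket σ (superBracket σ x y) (superBracket σ z w) = 0 := by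
  rw [superBracket_op hx hy, superBracket_op hz hw, superBracket_smul_smul,
    superBracket_op (superBracket_homogeneous σ hx hy) (superBracket_homogeneous σ hz hw)] at h
  simpa [smul_eq_zero] using h

variable {ι : Type*} {κ : Type*} [LinearOrder κ]

/-- The transpose of a matrix of series, with coefficients in the opposite ring. -/
noncomputable def transposeOp (M : Matrix ι ι A⟦X⟧) : Matrix ι ι Aᵐᵒᵖ⟦X⟧ :=
  Matrix.of fun i j => PowerSeries.mk fun n => op (coeff n (M j i))

omit [Algebra ℂ A] in
theorem coeff_transposeOp (M : Matrix ι ι A⟦X⟧) (i j : ι) (n : ℕ) :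
    coeff n (transposeOp M i j) = op (coeff n (M j i)) := by simp [transposeOp]

variable [DecidableEq ι]

/-- Transposition is an antiautomorphism of the relations: the sign from reversing the bracket turns
the sign of the transposed relation into the required one, up to an even exponent. -/
theorem IsSuperRTT.opposite {σ : A →ₐ[ℂ] A} {par : ι → ℕ} {t : ι → ι → ℕ → A}
    (ht : IsSuperRTT σ par t) :
    IsSuperRTT (AlgHom.op σ) par (fun i j r => op (t j i r)) where
  zero i j := by
    rw [ht.zero]
    by_cases h : i = j
    · subst h; simp
    · simp [h, Ne.symm h]
  parity i j r := by rw [add_comm (par i)]; exact homogeneous_op (ht.parity j i r)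
  comm i j h k r s := by
    rw [superBracket_op (ht.parity j i _) (ht.parity k h _),
      superBracket_op (ht.parity j i _) (ht.parity k h _), ← smul_sub, ← op_sub, ht.comm,
      op_smul, smul_smul, ← op_mul, ← op_mul, ← op_sub, ← neg_sub (t k i r * _), op_neg, smul_neg,
      ← neg_smul]
    congr 1
    rw [neg_mul, neg_inj, ← pow_add,
      show (par j + par i) * (par k + par h) + (par j * par i + par j * par k + par i * par k) =
        par i * par j + par i * par h + par j * par h + 2 * (par j * par k + par i * par k) by ring,
      pow_add, pow_mul]
    simp

variable [Fintype ι]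

omit [Algebra ℂ A] [DecidableEq ι] in
theorem transposeOp_mul (M N : Matrix ι ι A⟦X⟧) :
    transposeOp (M * N) = transposeOp N * transposeOp M := by
  ext i j n
  rw [coeff_transposeOp, Matrix.mul_apply, Matrix.mul_apply, map_sum, map_sum, Finset.op_sum]
  refine Finset.sum_congr rfl fun k _ => ?_
  rw [coeff_mul, coeff_mul, Finset.op_sum, ← Finset.Nat.sum_antidiagonal_swap]
  simp [coeff_transposeOp]

-- Transposing over the opposite ring reverses products, so $FDE$ becomes $E^tD^tF^t$, again of the
-- form lower, diagonal, upper.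
omit [Algebra ℂ A] in
theorem IsGaussDecomposition.transposeOp {b : ι → κ} {T F D E : Matrix ι ι A⟦X⟧}
    (h : IsGaussDecomposition b T F D E) :
    IsGaussDecomposition b (transposeOp T) (transposeOp E) (transposeOp D) (transposeOp F) := by
  have hone : ∀ i j n, op (coeff n ((1 : Matrix ι ι A⟦X⟧) j i))
      = coeff n ((1 : Matrix ι ι Aᵐᵒᵖ⟦X⟧) i j) := fun i j n => by
    by_cases hij : i = j
    · subst hij
      simp only [Matrix.one_apply_eq, coeff_one]
      split <;> simp
    · simp [hij, Ne.symm hij]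
  refine ⟨by rw [h.eq_mul, transposeOp_mul, transposeOp_mul, mul_assoc],
    ?_, ?_, ?_, ?_, ?_, ?_, ?_⟩ <;> intro i j hij
  · ext n; rw [coeff_transposeOp, h.diag j i hij.symm]; simp
  · ext n; rw [coeff_transposeOp, h.upper j i hij]; simp
  · ext n; rw [coeff_transposeOp, h.upper_unit j i hij.symm, hone]
  · rw [coeff_transposeOp, h.upper_coeff j i hij, op_zero]
  · ext n; rw [coeff_transposeOp, h.lower j i hij]; simp
  · ext n; rw [coeff_transposeOp, h.lower_unit j i hij.symm, hone]
  · rw [coeff_transposeOp, h.lower_coeff j i hij, op_zero]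

/-- The quartic Serre relation for the lower triangular factor. -/
theorem IsSuperRTT.superBracket_superBracket_lower_eq_zero {σ : A →ₐ[ℂ] A} {par : ι → ℕ}
    {t : ι → ι → ℕ → A} {b : ι → κ} {F D E : Matrix ι ι A⟦X⟧} (ht : IsSuperRTT σ par t)
    (hg : IsGaussDecomposition b (seriesMatrix t) F D E) {i h h₀ k k₀ g : ι} (j f : ι) (r s : ℕ)
    (hih : b i < b h) (hh : b h₀ = b h) (hhk : b h < b k) (hk : b k₀ = b k) (hfk : b f = b k)
    (hkg : b k < b g) (hcons : ∀ c, b k < b c → b g ≤ b c) :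
    superBracket σ (superBracket σ (coeff r (F j i)) (coeff 1 (F k h)))
      (superBracket σ (coeff 1 (F k₀ h₀)) (coeff s (F g f))) = 0 := by
  have hp := (ht.isParityMatrix.gauss hg ht.coeff_zero_toSeries).1
  refine superBracket_eq_zero_of_op (hp _ _ _) (hp _ _ _) (hp _ _ _) (hp _ _ _) ?_
  have hT : seriesMatrix (fun i j r => op (t j i r)) = SuperYangian.transposeOp (seriesMatrix t) := by
    ext i j n
    rw [coeff_transposeOp, coeff_seriesMatrix, coeff_seriesMatrix]
  have hg' := hg.transposeOp
  rw [← hT] at hg'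
  simpa only [coeff_transposeOp] using
    ht.opposite.superBracket_superBracket_eq_zero hg' j f r s hih hh hhk hk hfk hkg hcons

end Opposite

/-! ### The generators of the super Yangian and the block positions -/

section Yangian

variable (M N : ℕ)

theorem superBracket_gen (i j h k : Fin (M + N)) (r s : ℕ) :
    superBracket (parityAut M N) (gen M N i j r) (gen M N h k s) =
      (-1 : ℂ) ^ (parity M N i * parity M N j + parity M N i * parity M N h
            + parity M N j * parity M N h) •
          ∑ t ∈ Finset.range (min r s),
            (gen M N h j t * gen M N i k (r + s - 1 - t)
              - gen M N h j (r + s - 1 - t) * gen M N i k t) := by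
  have := RingQuot.mkAlgHom_rel ℂ (Rel.comm (M := M) (N := N) i j h k r s)
  change proj M N _ = proj M N _ at this
  rw [map_superBracket _ (parityAut M N) _ fun x => (parityAut_proj M N x).symm] at this
  simpa only [map_smul, map_sum, map_sub, map_mul, gen] using this

/-- The sums for $(r+1,s)$ and $(r,s+1)$ have the same summands, since both total $r+s+1$. They
differ by the single term $t=\min(r,s)$, and not at all when $r=s$. -/
theorem isSuperRTT_gen : IsSuperRTT (parityAut M N) (parity M N) (gen M N) where
  zero i j := by
    by_cases h : i = j <;> simp [gen, freeGen, h]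
  parity := parityAut_gen M N
  comm i j h k r s := by
    rw [superBracket_gen, superBracket_gen, ← smul_sub]
    congr 1
    rw [show r + (s + 1) - 1 = r + s by omega, show r + 1 + s - 1 = r + s by omega]
    rcases lt_trichotomy r s with hrs | rfl | hrs
    · rw [min_eq_left (show r + 1 ≤ s from hrs), min_eq_left (show r ≤ s + 1 by omega),
        Finset.sum_range_succ, add_sub_cancel_left, Nat.add_sub_cancel_left]
    · simp
    · rw [min_eq_right (show s ≤ r + 1 by omega), min_eq_right (show s + 1 ≤ r from hrs),
        Finset.sum_range_succ, Nat.add_sub_cancel]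
      abel

variable {M N} (lam : Composition M) (nu : Composition N)

theorem index_row (a : ℕ) (ha : 1 ≤ a ∧ a ≤ lam.length + nu.length) (i : Entry lam nu a ha) :
    (lam.append nu).index (row lam nu a ha i) = block lam nu a ha :=
  Composition.index_embedding _ _ _

end Yangian

end SuperYangian

theorem lemma7p2 {M N : ℕ} (lam : Composition M) (nu : Composition N)
    (hm : 1 < lam.length) (hn : 1 < nu.length) (r s : ℕ) (hr : 1 ≤ r) (hs : 1 ≤ s) :
    (∀ (i : Entry lam nu (lam.length - 1) (by omega))
        (j : Entry lam nu (lam.length - 1 + 1) (by omega))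
        (h h₀ : Entry lam nu lam.length (by omega))
        (k k₀ : Entry lam nu (lam.length + 1) (by omega))
        (f : Entry lam nu (lam.length + 1) (by omega))
        (g : Entry lam nu (lam.length + 2) (by omega)),
      bracket
        (bracket (E lam nu (lam.length - 1) (by omega) i j r)
          (E lam nu lam.length (by omega) h k 1))
        (bracket (E lam nu lam.length (by omega) h₀ k₀ 1)
          (E lam nu (lam.length + 1) (by omega) f g s)) = 0) ∧
    (∀ (i : Entry lam nu (lam.length - 1 + 1) (by omega))
        (j : Entry lam nu (lam.length - 1) (by omega))
        (h h₀ : Entry lam nu (lam.length + 1) (by omega))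
        (k k₀ : Entry lam nu lam.length (by omega))
        (f : Entry lam nu (lam.length + 2) (by omega))
        (g : Entry lam nu (lam.length + 1) (by omega)),
      bracket
        (bracket (F lam nu (lam.length - 1) (by omega) i j r)
          (F lam nu lam.length (by omega) h k 1))
        (bracket (F lam nu lam.length (by omega) h₀ k₀ 1)
          (F lam nu (lam.length + 1) (by omega) f g s)) = 0) := by
  have hg := gauss_spec lam nu
  have ht := isSuperRTT_gen M N
  constructor
  · intro i j h h₀ k k₀ f g
    refine ht.superBracket_superBracket_eq_zero (b := (lam.append nu).index) hg _ _ r s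
      ?_ ?_ ?_ ?_ ?_ ?_ ?_ <;>
    -- Block $a$ has index $a-1$, so the blocks in play have the consecutive indices
    -- $m-2,\dots,m+1$; the truncated subtractions are harmless because $m>1$.
    simp only [index_row, block, Fin.lt_def, Fin.le_def] <;> omega
  · intro i j h h₀ k k₀ f g
    refine ht.superBracket_superBracket_lower_eq_zero (b := (lam.append nu).index) hg _ _ r s
      ?_ ?_ ?_ ?_ ?_ ?_ ?_ <;>
    simp only [index_row, block, Fin.lt_def, Fin.le_def] <;> omega
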